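/- Let $n\ge d\ge 1$ be integers and let $\mathcal P_{d,n}$ be the set of partitions $\eta=(\eta_1\ge\cdots\ge\eta_d\ge 0)$ with $\eta_1\le n-d$. Let $\lambda,\mu,\nu\in\mathcal P_{d,n}$. **Puzzles.** A puzzle piece is one of the following figures with unit edges, in a fixed orientation, whose edges are labelled $0$ or $1$: an upward or downward pointing equilateral triangle with horizontal edge, all three labels equal (four pieces); the rhombus with two horizontal edges labelled $1$ and two edges of direction $60^\circ$ labelled $0$; the rhombus with two horizontal edges labelled $0$ and two edges of direction $120^\circ$ labelled $1$; the rhombus with vertical long diagonal whose upper left and lower right edges are labelled $1$ and whose other two edges are labelled $0$; and the *equivariant piece*, the rhombus with vertical long diagonal whose lower left and upper right edges are labelled $1$ and whose other two edges are labelled $0$. A puzzle $P$ is a partition, along the triangular lattice, of an upward pointing equilateral triangle of side length $n$ into puzzle pieces such that pieces sharing an edge have the same label on it. The labels on the northeast side (read top to bottom), the northwest side (bottom to top) and the south side (left to right) form three binary words. A word with exactly $d$ ones is assigned the partition $(\eta_1,\dots,\eta_d)$ where $\eta_j$ is the number of zeros to the right of the $j$-th one from the left. Let $\mathcal{LP}^{\nu+}_{\lambda,\mu}$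 be the set of puzzles for which the three words have exactly $d$ ones each and the partitions $\lambda,\mu,\nu$, in that order. Number the edges of the south side $1,\dots,n$ from right to left. The lines through the center of an equivariant piece $p$ parallel to the northwest side and to the northeast side meet the south side in the centers of edges number $e(p)$ and $f(p)$ respectively. Put $$c_P=\prod_{p}\bigl(y_{e(p)}-y_{f(p)}\bigr),\qquad C_P=\prod_{p}\bigl(Y_{n+1-f(p)}-Y_{n+1-e(p)}\bigr),$$ the products being over the equivariant pieces $p$ of $P$. **Tableaux.** The skew diagram $\lambda*\mu$ consists of the Young diagram $\lambda$ placed above and to the right of the reverse Young diagram $\mu$ (right and bottom justified, with rows of length $\mu_1,\mu_2,\dots$ from bottom to top). A skew barred tableau $L$ of this shape fills each box with an element of $\{1,\dots,d\}$, which may be barred if the box lies in $\mu$, so that the values (ignoring bars) weakly increase from left to right along rows and strictly increase from top to bottom along columns. The unbarred column word $L^u$ lists the unbarred entries column by column, from the rightmost column to the leftmost, each read from top to bottom; $\omega(L^u)_k$ is the number of $k$'s in it, and $L^u_{<a}$ is the part of it that is read before the entry $a$. For an entry $a$ in $\mu$ let $|a|$ be its value, $|a|'=d+1-|a|$, $r(a)$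 its row number (from the bottom) and $c(a)$ its column number (from the right) in $\mu$. Put $$c_L=\prod_{a\text{ barred}}\bigl(y_{|a|'+\omega(L^u_{<a})_{|a|}}-y_{|a|'+c(a)-r(a)}\bigr),\qquad C_L=\prod_{a\text{ barred}}\bigl(Y_{(n-d)+|a|-(c(a)-r(a))}-Y_{(n-d)+|a|-\omega(L^u_{<a})_{|a|}}\bigr).$$ Let $\mathcal{LR}^{\nu+}_{\lambda,\mu}$ be the set of skew barred tableaux $L$ of shape $\lambda*\mu$ such that $\omega(L^u)=\nu$, the word $L^u$ is Yamanouchi (every initial part contains at least as many $k$'s as $(k+1)$'s, for $1\le k<d$), and every factor $y_i-y_j$ of $c_L$ satisfies $i>j$. **Proposition.** There is a bijection $\Phi:\mathcal{LP}^{\nu+}_{\lambda,\mu}\to\mathcal{LR}^{\nu+}_{\lambda,\mu}$ such that for every $P$ one has $c_P=c_{\Phi(P)}$ and $C_P=C_{\Phi(P)}$, and moreover these are identical expressions: $c_P$ and $c_{\Phi(P)}$ have the same multiset of factors $y_i-y_j$, and $C_P$ and $C_{\Phi(P)}$ have the same multiset of factors $Y_i-Y_j$. -/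

import Mathlib

/-! Knutson-Tao puzzles and positive equivariant Littlewood-Richardson skew tableaux. -/

namespace PuzzleTableau

/-- The set `𝒫_{d,n}` of partitions `(η_1 ≥ ⋯ ≥ η_d)` of nonnegative integers with
`η_1 ≤ n - d` (used for `d ≤ n`); the part `η_{i+1}` is `η i`. -/
def boxPartitions (d n : ℕ) : Set (Fin d → ℕ) :=
  {η | Antitone η ∧ ∀ i, η i ≤ n - d}

/-! ### Puzzles

The triangle of side `n` is drawn in the triangular lattice; `(a, b)` stands for the lattice point
`a e₁ + b e₂`, with `e₁` the unit vector pointing east and `e₂` the unit vector at 60 degrees, so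
that the triangle has the vertices `(0, 0)`, `(n, 0)` and `(0, n)`. -/

/-- Unit edges of the lattice: `horiz a b` joins `(a, b)` and `(a + 1, b)`; `slash a b` joins
`(a, b)` and `(a, b + 1)` (parallel to the northwest side); `backslash a b` joins `(a + 1, b)` and
`(a, b + 1)` (parallel to the northeast side). -/
inductive Edge
  | horiz (a b : ℕ)
  | slash (a b : ℕ)
  | backslash (a b : ℕ)
  deriving DecidableEq

/-- Unit triangles of the lattice: `up a b` has the vertices `(a, b)`, `(a + 1, b)`, `(a, b + 1)`,
and `down a b` has the vertices `(a + 1, b)`, `(a, b + 1)`, `(a + 1, b + 1)`. -/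
inductive UnitTriangle
  | up (a b : ℕ)
  | down (a b : ℕ)
  deriving DecidableEq

/-- The unit triangle lies inside the big triangle of side `n`. -/
def UnitTriangle.Inside (n : ℕ) : UnitTriangle → Prop
  | .up a b => a + b + 1 ≤ n
  | .down a b => a + b + 2 ≤ n

/-- The eight kinds of puzzle pieces: four triangles with three equal labels, three
nonequivariant rhombi, and the equivariant rhombus. -/
inductive PieceKind
  | upOne | downOne | upZero | downZero
  | rhombusSlash | rhombusBackslash | rhombusVertical
  | equivariant
  deriving DecidableEq

/-- A puzzle piece placed in the lattice; `a` and `b` give its position. -/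
structure Piece where
  kind : PieceKind
  a : ℕ
  b : ℕ
  deriving DecidableEq

/-- The unit triangles that make up a placed piece. -/
def Piece.triangles : Piece → List UnitTriangle
  | ⟨.upOne, a, b⟩ => [.up a b]
  | ⟨.downOne, a, b⟩ => [.down a b]
  | ⟨.upZero, a, b⟩ => [.up a b]
  | ⟨.downZero, a, b⟩ => [.down a b]
  | ⟨.rhombusSlash, a, b⟩ => [.up a b, .down a b]
  | ⟨.rhombusBackslash, a, b⟩ => [.down a b, .up (a + 1) b]
  | ⟨.rhombusVertical, a, b⟩ => [.down a b, .up a (b + 1)]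
  | ⟨.equivariant, a, b⟩ => [.down a b, .up a (b + 1)]

/-- The boundary edges of a placed piece, with their labels. The nonequivariant rhombi are the
three rotations of one another; the equivariant piece is the vertical rhombus whose lower left and
upper right edges are labelled `1` and whose other two edges are labelled `0`. -/
def Piece.edges : Piece → List (Edge × Fin 2)
  | ⟨.upOne, a, b⟩ => [(.horiz a b, 1), (.slash a b, 1), (.backslash a b, 1)]
  | ⟨.downOne, a, b⟩ => [(.horiz a (b + 1), 1), (.slash (a + 1) b, 1), (.backslash a b, 1)]
  | ⟨.upZero, a, b⟩ => [(.horiz a b, 0), (.slash a b, 0), (.backslash a b, 0)]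
  | ⟨.downZero, a, b⟩ => [(.horiz a (b + 1), 0), (.slash (a + 1) b, 0), (.backslash a b, 0)]
  | ⟨.rhombusSlash, a, b⟩ =>
      [(.horiz a b, 1), (.horiz a (b + 1), 1), (.slash a b, 0), (.slash (a + 1) b, 0)]
  | ⟨.rhombusBackslash, a, b⟩ =>
      [(.horiz (a + 1) b, 0), (.horiz a (b + 1), 0), (.backslash a b, 1), (.backslash (a + 1) b, 1)]
  | ⟨.rhombusVertical, a, b⟩ =>
      [(.backslash a b, 0), (.slash (a + 1) b, 1), (.slash a (b + 1), 1), (.backslash a (b + 1), 0)]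
  | ⟨.equivariant, a, b⟩ =>
      [(.backslash a b, 1), (.slash (a + 1) b, 0), (.slash a (b + 1), 0), (.backslash a (b + 1), 1)]

/-- A puzzle of side length `n`: a partition of the big triangle into puzzle pieces such that
the labels of two pieces agree on every edge that the pieces share. -/
structure Puzzle (n : ℕ) where
  pieces : Finset Piece
  inside : ∀ p ∈ pieces, ∀ t ∈ p.triangles, t.Inside n
  cover : ∀ t : UnitTriangle, t.Inside n → ∃! p, p ∈ pieces ∧ t ∈ p.triangles
  agree : ∀ p ∈ pieces, ∀ q ∈ pieces, ∀ (e : Edge) (x y : Fin 2),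
    (e, x) ∈ p.edges → (e, y) ∈ q.edges → x = y

/-- The label of an edge of a puzzle: `1` if some piece has this edge with the label `1`, and
otherwise `0`. (Only used for edges on the boundary of the big triangle, each of which is an edge
of exactly one piece.) -/
def Puzzle.label {n : ℕ} (P : Puzzle n) (e : Edge) : Fin 2 :=
  if ∃ p ∈ P.pieces, (e, 1) ∈ p.edges then 1 else 0

/-- The labels of the northeast side, read from top to bottom. -/
def Puzzle.wordNE {n : ℕ} (P : Puzzle n) (k : Fin n) : Fin 2 :=
  P.label (.backslash k (n - 1 - k))

/-- The labels of the northwest side, read from bottom to top. -/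
def Puzzle.wordNW {n : ℕ} (P : Puzzle n) (k : Fin n) : Fin 2 :=
  P.label (.slash 0 k)

/-- The labels of the south side, read from left to right. -/
def Puzzle.wordS {n : ℕ} (P : Puzzle n) (k : Fin n) : Fin 2 :=
  P.label (.horiz k 0)

/-- The partition of an `n`-digit binary word with exactly `d` ones: its `j`-th part (`j` counted
from `1`) is the number of zeros to the right of the `j`-th one from the left, that is, the number
of zeros that are preceded by at least `j` ones. -/
def wordPartition {n : ℕ} (d : ℕ) (w : Fin n → Fin 2) (j : Fin d) : ℕ :=
  Fintype.card {p : Fin n // w p = 0 ∧ (j : ℕ) + 1 ≤ Fintype.card {q : Fin n // q < p ∧ w q = 1}}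

/-- The word `w` has exactly `d` ones, and its partition is `η`. -/
def HasPartition {n d : ℕ} (w : Fin n → Fin 2) (η : Fin d → ℕ) : Prop :=
  Fintype.card {q : Fin n // w q = 1} = d ∧ wordPartition d w = η

/-- The set of puzzles whose partitions along the northeast, the northwest and the south side are
`lam`, `mu` and `nu`. -/
def puzzles (d n : ℕ) (lam mu nu : Fin d → ℕ) : Set (Puzzle n) :=
  {P | HasPartition P.wordNE lam ∧ HasPartition P.wordNW mu ∧ HasPartition P.wordS nu}

/-- The equivariant pieces of a puzzle. -/
def Puzzle.equivariantPieces {n : ℕ} (P : Puzzle n) : Finset Piece :=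
  P.pieces.filter (fun p => p.kind = .equivariant)

/-- The number `e` (counted from right to left, from `1`) of the edge of the south side that is
met by the line from the center of the equivariant piece parallel to the northwest side.
The center is `(a + 1/2, b + 1)` in lattice coordinates, so the line meets the south side at
distance `a + 1/2` from its left end. -/
def Piece.edgeE (n : ℕ) (p : Piece) : ℤ := n - p.a

/-- The number `f` (counted from right to left, from `1`) of the edge of the south side that is
met by the line from the center of the equivariant piece parallel to the northeast side;
this line meets the south side at distance `a + b + 3/2` from its left end. -/
def Piece.edgeF (n : ℕ) (p : Piece) : ℤ := n - (p.a + p.b + 1)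

/-! An expression that is a product of differences of variables is recorded as the multiset of its
factors, where the pair `(i, j)` stands for the factor `y_i - y_j` (or `Y_i - Y_j`). Indices are
integers in order to avoid truncated subtraction. -/

/-- The polynomial that is the product of the differences `y_i - y_j` of variables over the pairs
`(i, j)` of a multiset. -/
noncomputable def evalFactors (s : Multiset (ℤ × ℤ)) : MvPolynomial ℤ ℂ :=
  (s.map (fun ij => MvPolynomial.X ij.1 - MvPolynomial.X ij.2)).prod

/-- The factors of the expression `c_P = ∏ (y_e - y_f)`. -/
def Puzzle.cFactors {n : ℕ} (P : Puzzle n) : Multiset (ℤ × ℤ) :=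
  P.equivariantPieces.val.map (fun p => (p.edgeE n, p.edgeF n))

/-- The factors of the expression `C_P = ∏ (Y_{n+1-f} - Y_{n+1-e})`. -/
def Puzzle.bigCFactors {n : ℕ} (P : Puzzle n) : Multiset (ℤ × ℤ) :=
  P.equivariantPieces.val.map (fun p => ((n : ℤ) + 1 - p.edgeF n, (n : ℤ) + 1 - p.edgeE n))

/-! ### Tableaux -/

/-- The boxes of the skew diagram `lam * mu`. A box `Sum.inl ⟨i, j⟩` lies in the Young diagram
`lam`, in row `i + 1` from the top and column `j + 1` from the left; a box `Sum.inr ⟨i, j⟩` lies in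
the reverse Young diagram `mu`, in row `i + 1` from the bottom and column `j + 1` from the right. -/
abbrev Box {d : ℕ} (lam mu : Fin d → ℕ) : Type :=
  (Σ i : Fin d, Fin (lam i)) ⊕ (Σ i : Fin d, Fin (mu i))

section Box

variable {d : ℕ} {lam mu : Fin d → ℕ}

/-- Horizontal position of a box in the plane, increasing to the right: `lam` occupies the
columns `0, 1, …` and `mu` the columns `-1, -2, …`, so `lam` is to the right of `mu`. -/
def Box.x : Box lam mu → ℤ
  | .inl c => (c.2 : ℕ)
  | .inr c => -((c.2 : ℕ) : ℤ) - 1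

/-- Vertical position of a box in the plane, increasing upwards: `mu` occupies the rows
`0, …, d - 1` and `lam` the rows `2d - 1, …, d`, so `lam` is above `mu`. -/
def Box.y : Box lam mu → ℤ
  | .inl c => 2 * (d : ℤ) - 1 - (c.1 : ℕ)
  | .inr c => (c.1 : ℕ)

/-- In the reading order of the column word, the box `b` comes strictly before the box `a`: columns
are read from right to left, and each column from top to bottom. -/
def Box.ReadBefore (b a : Box lam mu) : Prop :=
  Box.x a < Box.x b ∨ (Box.x b = Box.x a ∧ Box.y a < Box.y b)

instance (b a : Box lam mu) : Decidable (Box.ReadBefore b a) :=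
  inferInstanceAs (Decidable (_ ∨ _))

end Box

/-- A skew barred tableau of shape `lam * mu`, with entries in `{1, …, d}`, possibly barred.
The entry in the box `a` has the value `val a + 1`, and it is barred if `barred a = true`. -/
@[ext]
structure SkewBarredTableau {d : ℕ} (lam mu : Fin d → ℕ) where
  val : Box lam mu → Fin d
  barred : Box lam mu → Bool
  lam_unbarred : ∀ c, barred (Sum.inl c) = false
  row_weak : ∀ a b, Box.y a = Box.y b → Box.x a < Box.x b → val a ≤ val b
  col_strict : ∀ a b, Box.x a = Box.x b → Box.y b < Box.y a → val a < val b

namespace SkewBarredTableau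

variable {d : ℕ} {lam mu : Fin d → ℕ} (L : SkewBarredTableau lam mu)

/-- The number of unbarred entries with value `k + 1`, i.e. the `(k + 1)`-st entry of the
unbarred content `ω(L^u)`. -/
def content (k : Fin d) : ℕ :=
  (Finset.univ.filter (fun b => L.barred b = false ∧ L.val b = k)).card

/-- The number of unbarred entries with value `k + 1` that are read strictly before the box `a`,
i.e. the `(k + 1)`-st entry of `ω(L^u_{<a})`. -/
def contentBefore (a : Box lam mu) (k : Fin d) : ℕ :=
  (Finset.univ.filter (fun b => Box.ReadBefore b a ∧ L.barred b = false ∧ L.val b = k)).card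

/-- The number of unbarred entries with value `k + 1` that have been read just after the box `a`. -/
def contentUpTo (a : Box lam mu) (k : Fin d) : ℕ :=
  (Finset.univ.filter
    (fun b => (Box.ReadBefore b a ∨ b = a) ∧ L.barred b = false ∧ L.val b = k)).card

/-- The unbarred column word is Yamanouchi: wherever the reading stops, at least as many `k`'s as
`(k+1)`'s have been written down. -/
def IsYamanouchi : Prop :=
  ∀ (a : Box lam mu) (k k' : Fin d), (k' : ℕ) = (k : ℕ) + 1 →
    L.contentUpTo a k' ≤ L.contentUpTo a k

/-- The boxes with barred entries. They all lie in `mu`. -/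
def barredBoxes : Finset (Σ i : Fin d, Fin (mu i)) :=
  Finset.univ.filter (fun c => L.barred (Sum.inr c) = true)

/-- The value `|a|` of the entry in a box of `mu`. -/
def absVal (c : Σ i : Fin d, Fin (mu i)) : ℤ := ((L.val (Sum.inr c) : ℕ) : ℤ) + 1

/-- The number `ω(L^u_{<a})_{|a|}` for the entry `a` in a box of `mu`. -/
def omega (c : Σ i : Fin d, Fin (mu i)) : ℤ :=
  (L.contentBefore (Sum.inr c) (L.val (Sum.inr c)) : ℕ)

/-- The row number `r(a)`, counted from `1` from bottom to top. -/
def rowNum (c : Σ i : Fin d, Fin (mu i)) : ℤ := ((c.1 : ℕ) : ℤ) + 1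

/-- The column number `c(a)`, counted from `1` from right to left. -/
def colNum (c : Σ i : Fin d, Fin (mu i)) : ℤ := ((c.2 : ℕ) : ℤ) + 1

/-- The indices `(i, j)` of the factor `y_i - y_j` of `c_L` that belongs to the entry `a`:
`i = |a|' + ω(L^u_{<a})_{|a|}` and `j = |a|' + c(a) - r(a)`, where `|a|' = d + 1 - |a|`. -/
def cFactor (c : Σ i : Fin d, Fin (mu i)) : ℤ × ℤ :=
  ((d : ℤ) + 1 - L.absVal c + L.omega c, (d : ℤ) + 1 - L.absVal c + colNum c - rowNum c)

/-- The indices `(i, j)` of the factor `Y_i - Y_j` of `C_L` that belongs to the entry `a`: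
`i = (n - d) + |a| - (c(a) - r(a))` and `j = (n - d) + |a| - ω(L^u_{<a})_{|a|}`. -/
def bigCFactor (n : ℕ) (c : Σ i : Fin d, Fin (mu i)) : ℤ × ℤ :=
  ((n : ℤ) - d + L.absVal c - (colNum c - rowNum c), (n : ℤ) - d + L.absVal c - L.omega c)

/-- The factors of the expression `c_L`. -/
def cFactors : Multiset (ℤ × ℤ) := L.barredBoxes.val.map L.cFactor

/-- The factors of the expression `C_L`. -/
def bigCFactors (n : ℕ) : Multiset (ℤ × ℤ) := L.barredBoxes.val.map (L.bigCFactor n)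

/-- `c_L > 0`: each factor of `c_L` is of the form `y_i - y_j` with `i > j`. -/
def IsPositive : Prop := ∀ ij ∈ L.cFactors, ij.2 < ij.1

end SkewBarredTableau

/-- The set of positive equivariant Littlewood-Richardson skew tableaux of shape `lam * mu` and
unbarred content `nu`. -/
def positiveTableaux {d : ℕ} (lam mu nu : Fin d → ℕ) : Set (SkewBarredTableau lam mu) :=
  {L | L.IsYamanouchi ∧ L.content = nu ∧ L.IsPositive}

end PuzzleTableau

/-! Puzzles and tableaux are both encoded by the same pairs of arrays `(M, p)`, see `IsArray`; the
bijection is the composite of the two encodings.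

Puzzle side. Label also the diagonal inside each rhombus, by `mid` or `eqv`. A puzzle then amounts
to an edge labeling with a local rule at every unit triangle and a boundary rule that keeps rhombi
inside. Sweep the triangle by the lines `x + y = j`, parallel to the northeast side, from `j = n`
down to `j = 0`, and continue the labels trivially below the south side. Every line then carries
exactly `d` nonzero labels, called tokens here, each `one` or `mid`. From one line to the next a
token keeps its position or moves one step to the left, and only a `one` moves. The position of
token `u` is `p u j`, and `M u j` counts the ones among the tokens from `u` on. Ones are conserved
up to the flux through the slash edges (`Follows.numOnes_add`). This gives the interlacing
inequalities for `M`, and conversely all labels can be read off from `M` and `p`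
(`IsArray.exists_horiz`). Line `n` spells `lam`, line `0` spells `nu`, and `M 0` records the word of
`mu`.

Tableau side, with values counted from zero. `M u A` counts the entries `≥ u` of `mu` on the
diagonal `j - i = n - d + u - A`, together with virtual boxes beyond the right edge.
Semistandardness becomes interlacing. The equality `M u A = M (u + 1) (A + 1) + 1` says that this
diagonal has a box with value `u`, which is then unique. The box is unbarred exactly when token `u`
moves between the lines `A + 1` and `A`. Hence `n - d + u - p u j` is `lam u` plus the number of
unbarred entries `u` in `mu` on the diagonals from `j` on. Equal or neighbouring values are read in
the order of their diagonals (`readBefore_iff`), so the Yamanouchi property is the strict order of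
the tokens. Positivity says that tokens labelled `one` lie inside the triangle.

A barred box is thus a `one` that keeps its position although it could have moved. This is exactly
an equivariant piece, with `a = p u A` and `a + b + 1 = A`, and substitution identifies the factors
(`factors_eq`). -/

namespace PuzzleTableau

/-! ### Puzzles as edge labelings -/

/-- Labels of all edges of a puzzle, including the edges in the interior of a rhombus: `mid` for the
nonequivariant rhombi and `eqv` for the equivariant piece. -/
inductive Lab
  | zero | one | mid | eqv
  deriving DecidableEq

/-- The label of an edge on the boundary of a piece. -/
def Lab.ofFin (x : Fin 2) : Lab := if x = 1 then .one else .zero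

/-- Admissible labels of the slash, backslash and horizontal edges of an upward triangle. -/
def UpOK (s b h : Lab) : Prop :=
  (s = .zero ∧ b = .zero ∧ h = .zero) ∨ (s = .one ∧ b = .one ∧ h = .one) ∨
  (s = .zero ∧ b = .mid ∧ h = .one) ∨ (s = .mid ∧ b = .one ∧ h = .zero) ∨
  (s = .one ∧ b = .zero ∧ h = .mid) ∨ (s = .zero ∧ b = .one ∧ h = .eqv)

/-- Admissible labels of the backslash, horizontal and slash edges of a downward triangle. -/
def DownOK (b h s : Lab) : Prop :=
  (b = .zero ∧ h = .zero ∧ s = .zero) ∨ (b = .one ∧ h = .one ∧ s = .one) ∨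
  (b = .mid ∧ h = .one ∧ s = .zero) ∨ (b = .one ∧ h = .zero ∧ s = .mid) ∨
  (b = .zero ∧ h = .mid ∧ s = .one) ∨ (b = .one ∧ h = .eqv ∧ s = .zero)

/-- The edges of a unit triangle. -/
def UnitTriangle.edges : UnitTriangle → List Edge
  | .up a b => [.slash a b, .backslash a b, .horiz a b]
  | .down a b => [.backslash a b, .horiz a (b + 1), .slash (a + 1) b]

/-- The interior edges of a placed piece, with their labels. -/
def Piece.interior : Piece → List (Edge × Lab)
  | ⟨.rhombusSlash, a, b⟩ => [(.backslash a b, .mid)]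
  | ⟨.rhombusBackslash, a, b⟩ => [(.slash (a + 1) b, .mid)]
  | ⟨.rhombusVertical, a, b⟩ => [(.horiz a (b + 1), .mid)]
  | ⟨.equivariant, a, b⟩ => [(.horiz a (b + 1), .eqv)]
  | _ => []

/-- The labels of all edges of the piece are those given by `l`. -/
def Piece.Fits (l : Edge → Lab) (p : Piece) : Prop :=
  (∀ e x, (e, x) ∈ p.edges → l e = Lab.ofFin x) ∧ ∀ e x, (e, x) ∈ p.interior → l e = x

/-- All edge labels of a puzzle. -/
structure IsLabeling (n : ℕ) (l : Edge → Lab) : Prop where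
  up : ∀ a b, a + b + 1 ≤ n → UpOK (l (.slash a b)) (l (.backslash a b)) (l (.horiz a b))
  down : ∀ a b, a + b + 2 ≤ n →
    DownOK (l (.backslash a b)) (l (.horiz a (b + 1))) (l (.slash (a + 1) b))
  ne : ∀ a b, a + b + 1 = n → l (.backslash a b) ≠ .mid
  nw : ∀ b, b < n → l (.slash 0 b) ≠ .mid
  south : ∀ a, a < n → l (.horiz a 0) ≠ .mid ∧ l (.horiz a 0) ≠ .eqv

theorem Lab.ofFin_injective : Function.Injective Lab.ofFin := by
  intro x y
  fin_cases x <;> fin_cases y <;> simp [Lab.ofFin]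

theorem Piece.exists_triangle {p : Piece} {e : Edge} {x : Fin 2} (h : (e, x) ∈ p.edges) :
    ∃ t ∈ p.triangles, e ∈ t.edges := by
  obtain ⟨k, a, b⟩ := p
  cases e <;> cases k <;> simp [Piece.edges] at h <;> (try rcases h with h | h) <;>
    simp_all [Piece.triangles, UnitTriangle.edges]

theorem Piece.exists_triangle_interior {p : Piece} {e : Edge} {x : Lab} (h : (e, x) ∈ p.interior) :
    ∃ t ∈ p.triangles, e ∈ t.edges := by
  obtain ⟨k, a, b⟩ := p
  cases k <;> simp only [Piece.interior, List.mem_cons, Prod.mk.injEq, List.not_mem_nil,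
    or_false] at h <;> simp [Piece.triangles, UnitTriangle.edges, h.1]

/-- Both sides of the inner diagonal belong to the rhombus, so no second piece of a puzzle can meet
this edge. -/
theorem Piece.mem_triangles_of_interior {p : Piece} {e : Edge} {x : Lab} (h : (e, x) ∈ p.interior)
    {t : UnitTriangle} (ht : e ∈ t.edges) : t ∈ p.triangles := by
  obtain ⟨k, a, b⟩ := p
  cases k <;> simp only [Piece.interior, List.mem_cons, Prod.mk.injEq, List.not_mem_nil,
    or_false] at h <;> obtain ⟨rfl, rfl⟩ := h <;> cases t <;>
    simp_all [Piece.triangles, UnitTriangle.edges]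

theorem Piece.interior_not_edge {p : Piece} {e : Edge} {x : Lab} {y : Fin 2}
    (h : (e, x) ∈ p.interior) : (e, y) ∉ p.edges := by
  obtain ⟨k, a, b⟩ := p
  cases k <;> simp only [Piece.interior, List.mem_cons, Prod.mk.injEq, List.not_mem_nil,
    or_false] at h <;> obtain ⟨rfl, rfl⟩ := h <;> simp [Piece.edges]

theorem Piece.interior_unique {p : Piece} {e : Edge} {x y : Lab}
    (h : (e, x) ∈ p.interior) (h' : (e, y) ∈ p.interior) : x = y := by
  obtain ⟨k, a, b⟩ := p
  cases k <;> simp_all [Piece.interior]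

/-- Two pieces that contain the same triangle and fit the same labeling are equal. -/
theorem Piece.Fits.eq_of_mem {l : Edge → Lab} {p q : Piece} (hp : p.Fits l) (hq : q.Fits l)
    {t : UnitTriangle} (h : t ∈ p.triangles) (h' : t ∈ q.triangles) : p = q := by
  obtain ⟨k, a, b⟩ := p
  obtain ⟨k', a', b'⟩ := q
  cases t <;> cases k <;> simp [Piece.triangles] at h <;> obtain ⟨rfl, rfl⟩ := h <;>
    cases k' <;> simp [Piece.triangles] at h' <;> obtain ⟨rfl, rfl⟩ := h' <;>
    simp_all [Piece.Fits, Piece.edges, Piece.interior, Lab.ofFin]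

theorem Piece.Fits.upOK {l : Edge → Lab} {p : Piece} (hp : p.Fits l) {a b : ℕ}
    (h : .up a b ∈ p.triangles) :
    UpOK (l (.slash a b)) (l (.backslash a b)) (l (.horiz a b)) := by
  obtain ⟨k, a', b'⟩ := p
  cases k <;> simp [Piece.triangles] at h <;> obtain ⟨rfl, rfl⟩ := h <;>
    simp_all [Piece.Fits, Piece.edges, Piece.interior, Lab.ofFin, UpOK]

theorem Piece.Fits.downOK {l : Edge → Lab} {p : Piece} (hp : p.Fits l) {a b : ℕ}
    (h : .down a b ∈ p.triangles) :
    DownOK (l (.backslash a b)) (l (.horiz a (b + 1))) (l (.slash (a + 1) b)) := by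
  obtain ⟨k, a', b'⟩ := p
  cases k <;> simp [Piece.triangles] at h <;> obtain ⟨rfl, rfl⟩ := h <;>
    simp_all [Piece.Fits, Piece.edges, Piece.interior, Lab.ofFin, DownOK]

/-- An edge of a triangle in a piece is an edge of the piece or an interior edge. -/
theorem Piece.mem_edges_or_interior {p : Piece} {t : UnitTriangle} (h : t ∈ p.triangles) {e : Edge}
    (he : e ∈ t.edges) : (∃ x, (e, x) ∈ p.edges) ∨ ∃ x, (e, x) ∈ p.interior := by
  obtain ⟨k, a, b⟩ := p
  cases t <;> cases k <;> simp [Piece.triangles] at h <;> obtain ⟨rfl, rfl⟩ := h <;>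
    simp only [UnitTriangle.edges, List.mem_cons, List.not_mem_nil, or_false] at he <;>
    rcases he with he | he | he <;> subst he <;> simp [Piece.edges, Piece.interior]

namespace Puzzle

variable {n : ℕ} (P : Puzzle n)

/-- All edges of all pieces of the puzzle, including the interior ones, have the label given
by `l`. -/
def Fits (l : Edge → Lab) : Prop := ∀ p ∈ P.pieces, p.Fits l

theorem eq_of_triangle {p q : Piece} (hp : p ∈ P.pieces) (hq : q ∈ P.pieces) {t : UnitTriangle}
    (h : t ∈ p.triangles) (h' : t ∈ q.triangles) : p = q :=
  (P.cover t (P.inside p hp t h)).unique ⟨hp, h⟩ ⟨hq, h'⟩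

theorem interior_eq {p q : Piece} (hp : p ∈ P.pieces) (hq : q ∈ P.pieces) {e : Edge} {x : Lab}
    (h : (e, x) ∈ p.interior) {t : UnitTriangle} (ht : t ∈ q.triangles) (he : e ∈ t.edges) :
    p = q :=
  P.eq_of_triangle hp hq (Piece.mem_triangles_of_interior h he) ht

/-- The choice of a piece is harmless: on boundary edges of pieces by `agree`, and on inner
diagonals because only one piece contains them. -/
theorem exists_fits : ∃ l : Edge → Lab, P.Fits l := by
  classical
  refine ⟨fun e => if h : ∃ p ∈ P.pieces, ∃ x, (e, x) ∈ p.edges then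
      Lab.ofFin h.choose_spec.2.choose else
      if h : ∃ p ∈ P.pieces, ∃ x, (e, x) ∈ p.interior then h.choose_spec.2.choose else .zero, ?_⟩
  intro p hp
  refine ⟨fun e x hx => ?_, fun e x hx => ?_⟩
  · have h : ∃ p ∈ P.pieces, ∃ x, (e, x) ∈ p.edges := ⟨p, hp, x, hx⟩
    simp only [h, ↓reduceDIte]
    exact congrArg _ (P.agree _ h.choose_spec.1 _ hp e _ _ h.choose_spec.2.choose_spec hx)
  · have h0 : ¬ ∃ p ∈ P.pieces, ∃ x, (e, x) ∈ p.edges := by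
      rintro ⟨q, hq, y, hy⟩
      obtain ⟨t, ht, he⟩ := Piece.exists_triangle hy
      obtain rfl := P.interior_eq hp hq hx ht he
      exact Piece.interior_not_edge hx hy
    have h : ∃ p ∈ P.pieces, ∃ x, (e, x) ∈ p.interior := ⟨p, hp, x, hx⟩
    simp only [h0, h, ↓reduceDIte]
    have h2 := h.choose_spec.2.choose_spec
    obtain ⟨t, ht, he⟩ := Piece.exists_triangle_interior hx
    have := P.interior_eq h.choose_spec.1 hp h2 ht he
    exact Piece.interior_unique (this ▸ h2) hx

variable {P} {l l' : Edge → Lab}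

/-- The local rules are the list of pieces cut into triangles. An inner diagonal has a triangle of
its rhombus on either side, so it cannot lie on the boundary of the big triangle. -/
theorem Fits.isLabeling (hl : P.Fits l) : IsLabeling n l where
  up a b h := by
    obtain ⟨p, ⟨hp, ht⟩, -⟩ := P.cover (.up a b) h
    exact (hl p hp).upOK ht
  down a b h := by
    obtain ⟨p, ⟨hp, ht⟩, -⟩ := P.cover (.down a b) h
    exact (hl p hp).downOK ht
  ne a b h := by
    obtain ⟨p, ⟨hp, ht⟩, -⟩ := P.cover (.up a b) (show a + b + 1 ≤ n by omega)
    have hf := hl p hp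
    have hi := P.inside p hp
    obtain ⟨k, a', b'⟩ := p
    cases k <;> simp [Piece.triangles] at ht <;> obtain ⟨rfl, rfl⟩ := ht <;>
      simp_all [Piece.Fits, Piece.edges, Piece.interior, Lab.ofFin, Piece.triangles,
        UnitTriangle.Inside]
    all_goals omega
  nw b h := by
    obtain ⟨p, ⟨hp, ht⟩, -⟩ := P.cover (.up 0 b) (show 0 + b + 1 ≤ n by omega)
    have hf := hl p hp
    obtain ⟨k, a', b'⟩ := p
    cases k <;> simp [Piece.triangles] at ht <;> obtain ⟨rfl, rfl⟩ := ht <;>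
      simp_all [Piece.Fits, Piece.edges, Piece.interior, Lab.ofFin]
  south a h := by
    obtain ⟨p, ⟨hp, ht⟩, -⟩ := P.cover (.up a 0) (show a + 0 + 1 ≤ n by omega)
    have hf := hl p hp
    obtain ⟨k, a', b'⟩ := p
    cases k <;> simp [Piece.triangles] at ht <;> obtain ⟨rfl, rfl⟩ := ht <;>
      simp_all [Piece.Fits, Piece.edges, Piece.interior, Lab.ofFin]

/-- A piece is determined by one of its triangles and the labels, by `Piece.Fits.eq_of_mem`. -/
theorem Fits.eq {P' : Puzzle n} (h : P.Fits l) (h' : P'.Fits l) : P = P' := by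
  have key : ∀ {P P' : Puzzle n}, P.Fits l → P'.Fits l → P.pieces ⊆ P'.pieces := by
    intro P P' h h' p hp
    have hne : ∃ t, t ∈ p.triangles := by
      obtain ⟨k, a, b⟩ := p
      cases k <;> simp [Piece.triangles]
    obtain ⟨t, ht⟩ := hne
    obtain ⟨q, ⟨hq, hq'⟩, -⟩ := P'.cover t (P.inside p hp t ht)
    rwa [(h p hp).eq_of_mem (h' q hq) ht hq']
  have := (key h h').antisymm (key h' h)
  cases P; cases P'; simp_all

theorem Fits.eq_on (h : P.Fits l) (h' : P.Fits l') {t : UnitTriangle} (ht : t.Inside n) {e : Edge}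
    (he : e ∈ t.edges) : l e = l' e := by
  obtain ⟨p, ⟨hp, hpt⟩, -⟩ := P.cover t ht
  rcases Piece.mem_edges_or_interior hpt he with ⟨x, hx⟩ | ⟨x, hx⟩
  · rw [(h p hp).1 e x hx, (h' p hp).1 e x hx]
  · rw [(h p hp).2 e x hx, (h' p hp).2 e x hx]

theorem Fits.label_eq_one_iff (h : P.Fits l) {t : UnitTriangle} (ht : t.Inside n) {e : Edge}
    (he : e ∈ t.edges) : P.label e = 1 ↔ l e = .one := by
  rw [Puzzle.label]
  constructor
  · intro hh
    split_ifs at hh with h1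
    · obtain ⟨p, hp, hx⟩ := h1
      simp [(h p hp).1 _ _ hx, Lab.ofFin]
    · simp at hh
  · intro hh
    rw [if_pos]
    obtain ⟨p, ⟨hp, hpt⟩, -⟩ := P.cover t ht
    rcases Piece.mem_edges_or_interior hpt he with ⟨x, hx⟩ | ⟨x, hx⟩
    · refine ⟨p, hp, ?_⟩
      have := (h p hp).1 e x hx
      rw [hh] at this
      have : x = 1 := by
        by_contra hne
        simp [Lab.ofFin, hne] at this
      rwa [← this]
    · exfalso
      have := (h p hp).2 e x hx
      rw [hh] at this
      subst this
      obtain ⟨k, a, b⟩ := p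
      cases k <;> simp [Piece.interior] at hx

theorem Fits.congr (h : P.Fits l)
    (he : ∀ t : UnitTriangle, t.Inside n → ∀ e ∈ t.edges, l e = l' e) : P.Fits l' := by
  refine fun r hr => ⟨fun e x hx => ?_, fun e x hx => ?_⟩
  · obtain ⟨t, ht, het⟩ := Piece.exists_triangle hx
    rw [← he t (P.inside r hr t ht) e het, (h r hr).1 e x hx]
  · obtain ⟨t, ht, het⟩ := Piece.exists_triangle_interior hx
    rw [← he t (P.inside r hr t ht) e het, (h r hr).2 e x hx]

theorem Fits.equivariant_mem_iff (h : P.Fits l) {a b : ℕ} :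
    (⟨.equivariant, a, b⟩ : Piece) ∈ P.pieces ↔
      a + b + 2 ≤ n ∧ l (.horiz a (b + 1)) = .eqv := by
  constructor
  · intro hp
    refine ⟨P.inside _ hp (.down a b) (by simp [Piece.triangles]), ?_⟩
    exact (h _ hp).2 _ _ (by simp [Piece.interior])
  · rintro ⟨h1, h2⟩
    obtain ⟨p, ⟨hp, hpt⟩, -⟩ := P.cover (.down a b) h1
    have hf := h p hp
    obtain ⟨k, a', b'⟩ := p
    cases k <;> simp [Piece.triangles] at hpt <;> obtain ⟨rfl, rfl⟩ := hpt <;>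
      simp_all [Piece.Fits, Piece.edges, Piece.interior, Lab.ofFin]

end Puzzle

/-- Every admissible labeling comes from a puzzle. -/
theorem IsLabeling.exists_puzzle {n : ℕ} {l : Edge → Lab} (hl : IsLabeling n l) :
    ∃ P : Puzzle n, P.Fits l := by
  classical
  -- The puzzle consists of all pieces inside the triangle that fit the labeling; their coordinates
  -- are below `n`.
  have hfin : {p : Piece | p.Fits l ∧ ∀ t ∈ p.triangles, t.Inside n}.Finite := by
    let ks : Finset PieceKind := {.upOne, .downOne, .upZero, .downZero, .rhombusSlash,
      .rhombusBackslash, .rhombusVertical, .equivariant}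
    refine ((ks ×ˢ Finset.range n ×ˢ Finset.range n).image
      (fun x => (⟨x.1, x.2.1, x.2.2⟩ : Piece))).finite_toSet.subset ?_
    rintro ⟨k, a, b⟩ ⟨-, h⟩
    have h1 : a < n ∧ b < n := by
      cases k <;> simp [Piece.triangles, UnitTriangle.Inside] at h <;> omega
    simp only [Finset.coe_image, Set.mem_image, Finset.mem_coe, Finset.mem_product,
      Finset.mem_range]
    exact ⟨(k, a, b), ⟨by cases k <;> simp [ks], h1⟩, rfl⟩
  have hmem : ∀ p, p ∈ hfin.toFinset ↔ p.Fits l ∧ ∀ t ∈ p.triangles, t.Inside n := by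
    intro p; simp
  refine ⟨⟨hfin.toFinset, fun p hp => ((hmem p).1 hp).2, ?_, ?_⟩, fun p hp => ((hmem p).1 hp).1⟩
  · intro t ht
    refine existsUnique_of_exists_of_unique ?_ ?_
    · simp only [hmem]
      cases t with
      | up a b =>
        rcases hl.up a b ht with h | h | h | h | h | h
        · exact ⟨⟨.upZero, a, b⟩, by
            simp_all [Piece.Fits, Piece.edges, Piece.interior, Lab.ofFin, Piece.triangles]⟩
        · exact ⟨⟨.upOne, a, b⟩, by
            simp_all [Piece.Fits, Piece.edges, Piece.interior, Lab.ofFin, Piece.triangles]⟩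
        -- An edge labelled `mid` is not on the boundary, so the other half of the rhombus lies
        -- inside. The local rule there leaves only the matching half.
        · have hi : a + b + 2 ≤ n := by
            have := hl.ne a b
            simp only [UnitTriangle.Inside] at ht
            by_contra hc
            exact this (by omega) h.2.1
          have h2 := hl.down a b hi
          refine ⟨⟨.rhombusSlash, a, b⟩, ?_⟩
          simp_all [Piece.Fits, Piece.edges, Piece.interior, Lab.ofFin, Piece.triangles, DownOK,
            UnitTriangle.Inside]
          intro e
          constructor <;> rintro (rfl | rfl) <;> simp_all
        · obtain ⟨a', rfl⟩ : ∃ a', a = a' + 1 := by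
            rcases a with _ | a
            · exact absurd h.1 (hl.nw b (by simp only [UnitTriangle.Inside] at ht; omega))
            · exact ⟨a, rfl⟩
          have hi : a' + b + 2 ≤ n := by simp only [UnitTriangle.Inside] at ht; omega
          have h2 := hl.down a' b hi
          refine ⟨⟨.rhombusBackslash, a', b⟩, ?_⟩
          simp_all [Piece.Fits, Piece.edges, Piece.interior, Lab.ofFin, Piece.triangles, DownOK,
            UnitTriangle.Inside]
          intro e
          constructor <;> rintro (rfl | rfl) <;> simp_all
        · obtain ⟨b', rfl⟩ : ∃ b', b = b' + 1 := by
            rcases b with _ | b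
            · exact absurd h.2.2 (hl.south a (by simp only [UnitTriangle.Inside] at ht; omega)).1
            · exact ⟨b, rfl⟩
          have hi : a + b' + 2 ≤ n := by simp only [UnitTriangle.Inside] at ht; omega
          have h2 := hl.down a b' hi
          refine ⟨⟨.rhombusVertical, a, b'⟩, ?_⟩
          simp_all [Piece.Fits, Piece.edges, Piece.interior, Lab.ofFin, Piece.triangles, DownOK,
            UnitTriangle.Inside]
          intro e
          constructor <;> rintro (rfl | rfl) <;> simp_all
        · obtain ⟨b', rfl⟩ : ∃ b', b = b' + 1 := by
            rcases b with _ | b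
            · exact absurd h.2.2 (hl.south a (by simp only [UnitTriangle.Inside] at ht; omega)).2
            · exact ⟨b, rfl⟩
          have hi : a + b' + 2 ≤ n := by simp only [UnitTriangle.Inside] at ht; omega
          have h2 := hl.down a b' hi
          refine ⟨⟨.equivariant, a, b'⟩, ?_⟩
          simp_all [Piece.Fits, Piece.edges, Piece.interior, Lab.ofFin, Piece.triangles, DownOK,
            UnitTriangle.Inside]
          intro e
          constructor <;> rintro (rfl | rfl) <;> simp_all
      | down a b =>
        have hi : a + b + 2 ≤ n := ht
        rcases hl.down a b ht with h | h | h | h | h | h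
        · exact ⟨⟨.downZero, a, b⟩, by
            simp_all [Piece.Fits, Piece.edges, Piece.interior, Lab.ofFin, Piece.triangles]⟩
        · exact ⟨⟨.downOne, a, b⟩, by
            simp_all [Piece.Fits, Piece.edges, Piece.interior, Lab.ofFin, Piece.triangles]⟩
        · have h2 := hl.up a b (by omega)
          have h3 : a + b + 1 ≤ n := by omega
          refine ⟨⟨.rhombusSlash, a, b⟩, ?_⟩
          simp_all [Piece.Fits, Piece.edges, Piece.interior, Lab.ofFin, Piece.triangles, UpOK,
            UnitTriangle.Inside]
          intro e
          constructor <;> rintro (rfl | rfl) <;> simp_all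
        · have h2 := hl.up (a + 1) b (by omega)
          have h3 : a + 1 + b + 1 ≤ n := by omega
          refine ⟨⟨.rhombusBackslash, a, b⟩, ?_⟩
          simp_all [Piece.Fits, Piece.edges, Piece.interior, Lab.ofFin, Piece.triangles, UpOK,
            UnitTriangle.Inside]
          intro e
          constructor <;> rintro (rfl | rfl) <;> simp_all
        · have h2 := hl.up a (b + 1) (by omega)
          have h3 : a + (b + 1) + 1 ≤ n := by omega
          refine ⟨⟨.rhombusVertical, a, b⟩, ?_⟩
          simp_all [Piece.Fits, Piece.edges, Piece.interior, Lab.ofFin, Piece.triangles, UpOK,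
            UnitTriangle.Inside]
          intro e
          constructor <;> rintro (rfl | rfl) <;> simp_all
        · have h2 := hl.up a (b + 1) (by omega)
          have h3 : a + (b + 1) + 1 ≤ n := by omega
          refine ⟨⟨.equivariant, a, b⟩, ?_⟩
          simp_all [Piece.Fits, Piece.edges, Piece.interior, Lab.ofFin, Piece.triangles, UpOK,
            UnitTriangle.Inside]
          intro e
          constructor <;> rintro (rfl | rfl) <;> simp_all
    · rintro p q ⟨hp, hpt⟩ ⟨hq, hqt⟩
      exact ((hmem p).1 hp).1.eq_of_mem ((hmem q).1 hq).1 hpt hqt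
  · intro p hp q hq e x y hx hy
    exact Lab.ofFin_injective
      ((((hmem p).1 hp).1.1 e x hx).symm.trans (((hmem q).1 hq).1.1 e y hy))


/-! ### Binary words and partitions -/

/-- The partition of a word whose ones are in the positions `q 0 < q 1 < ⋯`. -/
theorem wordPartition_add {n d : ℕ} {w : Fin n → Fin 2} {q : Fin d → Fin n} (hq : StrictMono q)
    (hw : ∀ a, w a = 1 ↔ ∃ i, q i = a) :
    Fintype.card {a : Fin n // w a = 1} = d ∧
      ∀ i : Fin d, wordPartition d w i + q i + d = n + i := by
  have hset : Finset.univ.filter (fun a => w a = 1) = Finset.univ.image q := by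
    ext a; simp [hw]
  have hd : d ≤ n := by simpa using Fintype.card_le_of_injective q hq.injective
  refine ⟨by rw [Fintype.card_subtype, hset, Finset.card_image_of_injective _ hq.injective]; simp,
    fun i => ?_⟩
  have hcnt : ∀ p : Fin n, (i : ℕ) + 1 ≤ Fintype.card {b : Fin n // b < p ∧ w b = 1} ↔ q i < p := by
    intro p
    have h1 : Finset.univ.filter (fun b => b < p ∧ w b = 1)
        = (Finset.univ.filter (fun u : Fin d => q u < p)).image q := by
      ext b
      simp only [Finset.mem_filter, Finset.mem_univ, true_and, hw, Finset.mem_image]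
      constructor
      · rintro ⟨h, u, rfl⟩; exact ⟨u, h, rfl⟩
      · rintro ⟨u, h, rfl⟩; exact ⟨h, u, rfl⟩
    rw [Fintype.card_subtype, h1, Finset.card_image_of_injective _ hq.injective]
    constructor
    · intro h
      by_contra hc
      have : Finset.univ.filter (fun u : Fin d => q u < p) ⊆ Finset.Iio i := by
        intro u hu
        simp only [Finset.mem_filter, Finset.mem_univ, true_and] at hu
        simp only [Finset.mem_Iio]
        exact hq.lt_iff_lt.1 (lt_of_lt_of_le hu (not_lt.1 hc))
      have := Finset.card_le_card this
      simp at this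
      omega
    · intro h
      have : Finset.Iic i ⊆ Finset.univ.filter (fun u : Fin d => q u < p) := by
        intro u hu
        simp only [Finset.mem_Iic] at hu
        simp only [Finset.mem_filter, Finset.mem_univ, true_and]
        exact lt_of_le_of_lt (hq.monotone hu) h
      have := Finset.card_le_card this
      simpa using this
  have h2 : wordPartition d w i = (Finset.univ.filter (fun p => w p = 0 ∧ q i < p)).card := by
    rw [wordPartition, Fintype.card_subtype]
    congr 1
    ext p
    simp [hcnt]
  -- The letters after the one number `i` are the zeros counted by the partition and the later ones.
  have h3 : (Finset.univ.filter (fun p => w p = 0 ∧ q i < p)).card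
      + ((Finset.Ioi i).image q).card = (Finset.Ioi (q i)).card := by
    rw [← Finset.card_union_of_disjoint]
    · congr 1
      ext p
      simp only [Finset.mem_union, Finset.mem_filter, Finset.mem_univ, true_and, Finset.mem_image,
        Finset.mem_Ioi]
      constructor
      · rintro (⟨-, h⟩ | ⟨u, hu, rfl⟩)
        · exact h
        · exact hq hu
      · intro h
        by_cases h0 : w p = 1
        · obtain ⟨u, rfl⟩ := (hw p).1 h0
          exact Or.inr ⟨u, hq.lt_iff_lt.1 h, rfl⟩
        · exact Or.inl ⟨by omega, h⟩
    · rw [Finset.disjoint_left]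
      intro p hp hp'
      simp only [Finset.mem_filter, Finset.mem_univ, true_and, Finset.mem_image] at hp hp'
      obtain ⟨u, -, rfl⟩ := hp'
      have := (hw (q u)).2 ⟨u, rfl⟩
      simp [hp.1] at this
  rw [Finset.card_image_of_injective _ hq.injective] at h3
  simp at h3
  omega

/-- The positions of the ones in the word of a partition. -/
theorem hasPartition_iff {n d : ℕ} (hdn : d ≤ n) {w : Fin n → Fin 2} {eta : Fin d → ℕ}
    (h : eta ∈ boxPartitions d n) :
    HasPartition w eta ↔ ∀ a : Fin n, w a = 1 ↔ ∃ i : Fin d, (a : ℕ) + eta i = n - d + i := by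
  constructor
  · rintro ⟨h1, h2⟩
    rw [Fintype.card_subtype] at h1
    set S := Finset.univ.filter (fun a => w a = 1) with hS
    have hw : ∀ a, w a = 1 ↔ ∃ i, S.orderEmbOfFin h1 i = a := by
      intro a
      have := Finset.range_orderEmbOfFin S h1
      rw [← Set.mem_range, this]
      simp [hS]
    have h3 := (wordPartition_add (S.orderEmbOfFin h1).strictMono hw).2
    rw [h2] at h3
    intro a
    rw [hw]
    refine exists_congr fun i => ?_
    have := h3 i
    rw [Fin.ext_iff]
    omega
  · intro hw
    have hle := h.2
    -- The one number `i` is preceded by `i` ones and `n - d - eta i` zeros.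
    have hb : ∀ i : Fin d, n - d + i - eta i < n := fun i => by
      have := i.2; omega
    have hq : StrictMono (fun i : Fin d => (⟨n - d + i - eta i, hb i⟩ : Fin n)) := by
      intro i j hij
      have := h.1 hij.le
      have := hle i
      have := hle j
      have : (i : ℕ) < j := hij
      simp only [Fin.mk_lt_mk]
      omega
    have := wordPartition_add (w := w) hq (fun a => by
      rw [hw]
      refine exists_congr fun i => ?_
      have := hle i
      simp only [Fin.ext_iff]
      omega)
    refine ⟨this.1, funext fun i => ?_⟩
    have h4 := this.2 i
    have := hle i
    simp only at h4
    omega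


/-! ### Pairs of arrays, and the puzzles they define -/

/-- Interlacing arrays whose first row is given by the partition `mu`. -/
structure IsShape (d n : ℕ) (mu : Fin d → ℕ) (M : ℕ → ℕ → ℕ) : Prop where
  last : ∀ j ≤ n, M d j = 0
  start : ∀ u ≤ d, M u 0 = 0
  finish : ∀ u ≤ d, M u n = d - u
  row : ∀ u < d, ∀ j ≤ n, M (u + 1) j ≤ M u j ∧ M u j ≤ M (u + 1) j + 1
  col : ∀ u ≤ d, ∀ A < n, M u A ≤ M u (A + 1) ∧ M u (A + 1) ≤ M u A + 1
  diag : ∀ u < d, ∀ A < n, M (u + 1) (A + 1) ≤ M u A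
  first : ∀ i : Fin d, ∀ A ≤ n, (i : ℕ) + 1 ≤ M 0 A ↔ n - d + i < A + mu i

/-- The arrays that interpolate between puzzles and tableaux. For the line `x + y = j` of the
triangle, `p u j` is the position of the nonzero label number `u` on this line, and `M u j` is the
number of labels `one` among the nonzero labels from number `u` on. -/
structure IsArray (d n : ℕ) (lam mu nu : Fin d → ℕ) (M p : ℕ → ℕ → ℕ) : Prop
    extends IsShape d n mu M where
  step : ∀ u < d, ∀ A < n,
    p u A = p u (A + 1) ∨ (p u A + 1 = p u (A + 1) ∧ M u A = M (u + 1) (A + 1) + 1)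
  lt_succ : ∀ u, u + 1 < d → ∀ j ≤ n, p u j < p (u + 1) j
  top : ∀ i : Fin d, p i n + lam i = n - d + i
  bot : ∀ i : Fin d, p i 0 + nu i = n - d + i
  pos : ∀ u < d, ∀ j ≤ n, M u j = M (u + 1) j + 1 → p u j < j

/-- The label in position `a` of the line `x + y = j`. -/
noncomputable def wLab (d : ℕ) (M p : ℕ → ℕ → ℕ) (j a : ℕ) : Lab :=
  open Classical in
  if ∃ u < d, p u j = a ∧ M u j = M (u + 1) j + 1 then .one
  else if ∃ u < d, p u j = a then .mid else .zero

/-- The number of nonzero labels on the line `x + y = j` before the position `a`. -/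
def numBefore (d : ℕ) (p : ℕ → ℕ → ℕ) (j a : ℕ) : ℕ :=
  ((Finset.range d).filter (fun u => p u j < a)).card

/-- The label of the slash edge that starts in position `a` of the line `x + y = A`. -/
noncomputable def xLab (d : ℕ) (M p : ℕ → ℕ → ℕ) (A a : ℕ) : Lab :=
  open Classical in
  if ∃ u < d, p u (A + 1) = a ∧ p u A + 1 = a then .mid
  else if M (numBefore d p (A + 1) a) (A + 1) = M (numBefore d p (A + 1) a) A + 1 then .one
  else .zero

/-- The label of the horizontal edge of an upward triangle in terms of the labels of its slash and
its backslash edge. -/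
def horizLab : Lab → Lab → Lab
  | .zero, .zero => .zero
  | .zero, .mid => .one
  | .zero, .one => .eqv
  | .one, .zero => .mid
  | .one, .one => .one
  | _, _ => .zero

/-- The labeling of the edges that is given by a pair of arrays. -/
noncomputable def arrayLab (d : ℕ) (M p : ℕ → ℕ → ℕ) : Edge → Lab
  | .backslash a b => wLab d M p (a + b + 1) a
  | .slash a b => xLab d M p (a + b) a
  | .horiz a b => horizLab (xLab d M p (a + b) a) (wLab d M p (a + b + 1) a)

theorem UpOK.horiz_eq {s b h : Lab} (H : UpOK s b h) : h = horizLab s b := by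
  rcases H with H | H | H | H | H | H <;> obtain ⟨rfl, rfl, rfl⟩ := H <;> rfl

/-- Number of elements of a strictly increasing sequence before one of its elements. -/
theorem numBefore_self {d j u : ℕ} {p : ℕ → ℕ → ℕ} (hp : ∀ v w, v < w → w < d → p v j < p w j)
    (hu : u < d) : numBefore d p j (p u j) = u := by
  have : (Finset.range d).filter (fun v => p v j < p u j) = Finset.range u := by
    ext v
    simp only [Finset.mem_filter, Finset.mem_range]
    constructor
    · rintro ⟨h1, h2⟩
      by_contra hc
      rcases Nat.lt_or_eq_of_le (not_lt.1 hc) with h | h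
      · exact absurd (hp u v h h1) (by omega)
      · subst h; omega
    · exact fun h => ⟨h.trans hu, hp v u h hu⟩
  rw [numBefore, this, Finset.card_range]

theorem numBefore_succ_self {d j u : ℕ} {p : ℕ → ℕ → ℕ}
    (hp : ∀ v w, v < w → w < d → p v j < p w j) (hu : u < d) :
    numBefore d p j (p u j + 1) = u + 1 := by
  have : (Finset.range d).filter (fun v => p v j < p u j + 1) = Finset.range (u + 1) := by
    ext v
    simp only [Finset.mem_filter, Finset.mem_range]
    constructor
    · rintro ⟨h1, h2⟩
      by_contra hc
      exact absurd (hp u v (by omega) h1) (by omega)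
    · intro h
      refine ⟨by omega, ?_⟩
      rcases Nat.lt_or_eq_of_le (Nat.le_of_lt_succ h) with h | h
      · exact (hp v u h hu).trans (by omega)
      · subst h; omega
  rw [numBefore, this, Finset.card_range]

theorem numBefore_succ_of_forall_ne {d j a : ℕ} {p : ℕ → ℕ → ℕ} (h : ∀ u < d, p u j ≠ a) :
    numBefore d p j (a + 1) = numBefore d p j a := by
  rw [numBefore, numBefore]
  congr 1
  ext v
  simp only [Finset.mem_filter, Finset.mem_range]
  refine and_congr_right fun hv => ?_
  have := h v hv
  omega

theorem numBefore_le {d j a : ℕ} {p : ℕ → ℕ → ℕ} : numBefore d p j a ≤ d :=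
  (Finset.card_filter_le _ _).trans_eq (Finset.card_range d)

theorem le_of_lt_numBefore {d j a u : ℕ} {p : ℕ → ℕ → ℕ}
    (hp : ∀ v w, v < w → w < d → p v j < p w j) (hu : u < d) (h : numBefore d p j a ≤ u) :
    a ≤ p u j := by
  by_contra hc
  have : Finset.range (u + 1) ⊆ (Finset.range d).filter (fun v => p v j < a) := by
    intro v hv
    simp only [Finset.mem_filter, Finset.mem_range] at hv ⊢
    refine ⟨by omega, ?_⟩
    rcases Nat.lt_or_eq_of_le (Nat.le_of_lt_succ hv) with h | h
    · exact (hp v u h hu).trans (by omega)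
    · subst h; omega
  have := Finset.card_le_card this
  rw [Finset.card_range] at this
  rw [numBefore] at h
  omega

theorem numBefore_all {d j a : ℕ} {p : ℕ → ℕ → ℕ} (h : ∀ u < d, p u j < a) :
    numBefore d p j a = d := by
  rw [numBefore, Finset.filter_true_of_mem (by simpa using h), Finset.card_range]

namespace IsArray

variable {d n : ℕ} {lam mu nu : Fin d → ℕ} {M p : ℕ → ℕ → ℕ} (h : IsArray d n lam mu nu M p)
include h

theorem lt_of_lt {j : ℕ} (hj : j ≤ n) : ∀ v w, v < w → w < d → p v j < p w j := by
  intro v w hvw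
  induction w, hvw using Nat.le_induction with
  | base => exact fun hw => h.lt_succ v hw j hj
  | succ w _ ih => exact fun hw => (ih (by omega)).trans (h.lt_succ w hw j hj)

theorem inj {j u v : ℕ} (hj : j ≤ n) (hu : u < d) (hv : v < d) (e : p u j = p v j) : u = v := by
  rcases lt_trichotomy u v with h1 | h1 | h1
  · exact absurd (h.lt_of_lt hj u v h1 hv) (by omega)
  · exact h1
  · exact absurd (h.lt_of_lt hj v u h1 hu) (by omega)

theorem wLab_of_eq {j u : ℕ} (hj : j ≤ n) (hu : u < d) :
    (wLab d M p j (p u j) = .one ∧ M u j = M (u + 1) j + 1) ∨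
      (wLab d M p j (p u j) = .mid ∧ M u j = M (u + 1) j) := by
  have hr := h.row u hu j hj
  by_cases hc : M u j = M (u + 1) j + 1
  · left
    exact ⟨by rw [wLab, if_pos ⟨u, hu, rfl, hc⟩], hc⟩
  · right
    refine ⟨?_, by omega⟩
    rw [wLab, if_neg, if_pos ⟨u, hu, rfl⟩]
    rintro ⟨v, hv, h1, h2⟩
    obtain rfl := h.inj hj hv hu h1
    exact hc h2

omit h in
theorem _root_.PuzzleTableau.wLab_of_ne {j a : ℕ} (ha : ∀ u < d, p u j ≠ a) :
    wLab d M p j a = .zero := by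
  rw [wLab, if_neg, if_neg]
  · rintro ⟨u, hu, h1⟩; exact ha u hu h1
  · rintro ⟨u, hu, h1, -⟩; exact ha u hu h1

omit h in
theorem _root_.PuzzleTableau.xLab_of_not_mid {A a : ℕ}
    (ha : ∀ u < d, ¬ (p u (A + 1) = a ∧ p u A + 1 = a)) :
    xLab d M p A a = if M (numBefore d p (A + 1) a) (A + 1) = M (numBefore d p (A + 1) a) A + 1
      then .one else .zero := by
  rw [xLab, if_neg]
  rintro ⟨u, hu, h1⟩
  exact ha u hu h1

/-- The labels around the two triangles in position `a` of the strip between two neighbouring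
lines. -/
theorem exists_horiz {A a : ℕ} (hA : A < n) :
    ∃ x, UpOK (xLab d M p A a) (wLab d M p (A + 1) a) x ∧
      DownOK (wLab d M p A a) x (xLab d M p A (a + 1)) := by
  have hlt := h.lt_of_lt (j := A + 1) (by omega)
  -- The cases: a token in position `a` of the outer line that moves or stays; no such token, but
  -- one that arrives from `a + 1`; no token on either line.
  by_cases h1 : ∃ u < d, p u (A + 1) = a
  · obtain ⟨u, hu, rfl⟩ := h1
    have hst := h.step u hu A hA
    have hr := h.row u hu A hA.le
    have hr' := h.row u hu (A + 1) hA
    have hc := h.col u hu.le A hA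
    have hc' := h.col (u + 1) hu A hA
    have hd := h.diag u hu A hA
    have ho := h.wLab_of_eq (j := A + 1) hA hu
    by_cases hU : p u A + 1 = p u (A + 1)
    · have hD : M u A = M (u + 1) (A + 1) + 1 := by omega
      have hx : xLab d M p A (p u (A + 1)) = .mid := by
        rw [xLab, if_pos ⟨u, hu, rfl, hU⟩]
      have ho' : wLab d M p (A + 1) (p u (A + 1)) = .one := by
        rcases ho with ho | ho
        · exact ho.1
        · omega
      refine ⟨.zero, by simp [hx, ho', UpOK], ?_⟩
      -- The vacated position is either refilled from the right by a later token, which also moves,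
      -- or empty on the inner line.
      by_cases h2 : ∃ v < d, p v A = p u (A + 1)
      · obtain ⟨v, hv, hve⟩ := h2
        have hst' := h.step v hv A hA
        have hne : u ≠ v := by rintro rfl; omega
        have huv : u < v := by
          by_contra hc
          have := h.lt_of_lt hA.le v u (by omega) hu
          omega
        have := hlt u v huv hv
        have hi := h.wLab_of_eq (j := A) hA.le hv
        have hrv := h.row v hv A hA.le
        have hcv := h.col (v + 1) hv A hA
        rw [hve] at hi
        have hx' : xLab d M p A (p u (A + 1) + 1) = .mid := by
          rw [xLab, if_pos ⟨v, hv, by omega, by omega⟩]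
        rcases hi with hi | hi
        · simp [hi.1, hx', DownOK]
        · omega
      · push Not at h2
        have hx' : xLab d M p A (p u (A + 1) + 1) = .zero := by
          rw [xLab_of_not_mid, numBefore_succ_self hlt hu, if_neg]
          · omega
          · rintro v hv ⟨h3, h4⟩
            exact h2 v hv (by omega)
        simp [wLab_of_ne h2, hx', DownOK]
    · have hp : p u A = p u (A + 1) := by omega
      have hx : xLab d M p A (p u (A + 1)) = if M u (A + 1) = M u A + 1 then .one else .zero := by
        rw [xLab_of_not_mid, numBefore_self hlt hu]
        rintro v hv ⟨h3, h4⟩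
        obtain rfl := h.inj hA hv hu h3
        exact hU h4
      have hx' : xLab d M p A (p u (A + 1) + 1) =
          if M (u + 1) (A + 1) = M (u + 1) A + 1 then .one else .zero := by
        rw [xLab_of_not_mid, numBefore_succ_self hlt hu]
        rintro v hv ⟨h3, h4⟩
        obtain rfl := h.inj hA.le hv hu (by omega)
        omega
      have hi := h.wLab_of_eq (j := A) hA.le hu
      rw [hp] at hi
      rw [hx, hx']
      rcases ho with ⟨ho, ho1⟩ | ⟨ho, ho1⟩ <;> rcases hi with ⟨hi, hi1⟩ | ⟨hi, hi1⟩ <;>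
        rw [ho, hi] <;> split_ifs <;> first | omega | simp [UpOK, DownOK]
  · push Not at h1
    have hx : xLab d M p A a =
        if M (numBefore d p (A + 1) a) (A + 1) = M (numBefore d p (A + 1) a) A + 1
          then .one else .zero :=
      xLab_of_not_mid (by rintro v hv ⟨h3, h4⟩; exact h1 v hv h3)
    by_cases h2 : ∃ v < d, p v A = a
    · obtain ⟨v, hv, rfl⟩ := h2
      have hst := h.step v hv A hA
      have := h1 v hv
      have hp : p v (A + 1) = p v A + 1 := by omega
      have hnb : numBefore d p (A + 1) (p v A) = v := by
        rw [← numBefore_succ_of_forall_ne h1, ← hp, numBefore_self hlt hv]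
      have hr := h.row v hv A hA.le
      have hr' := h.row v hv (A + 1) hA
      have hcv := h.col (v + 1) hv A hA
      have hx' : xLab d M p A (p v A + 1) = .mid := by
        rw [xLab, if_pos ⟨v, hv, hp, rfl⟩]
      have hi := h.wLab_of_eq (j := A) hA.le hv
      rw [hnb, if_neg (by omega)] at hx
      refine ⟨.zero, by simp [hx, wLab_of_ne h1, UpOK], ?_⟩
      rcases hi with hi | hi
      · simp [hi.1, hx', DownOK]
      · omega
    · push Not at h2
      have hx' : xLab d M p A (a + 1) = xLab d M p A a := by
        rw [hx, xLab_of_not_mid, numBefore_succ_of_forall_ne h1]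
        rintro v hv ⟨h3, h4⟩
        exact h2 v hv (by omega)
      rw [wLab_of_ne h1, wLab_of_ne h2, hx', hx]
      split_ifs <;> simp [UpOK, DownOK]

theorem wLab_ne_one {j a : ℕ} (hj : j ≤ n) (ha : j ≤ a) : wLab d M p j a ≠ .one := by
  rw [wLab]
  split_ifs with h1 h2
  · obtain ⟨u, hu, rfl, h2⟩ := h1
    have := h.pos u hu j hj h2
    omega
  · simp
  · simp

/-- A label `one` here would mean that a token in a position `≥ A + 1` of line `A + 1` is a `one`,
against `pos`. -/
theorem xLab_last {A : ℕ} (hA : A < n) : xLab d M p A (A + 1) ≠ .one := by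
  have hlt := h.lt_of_lt (j := A + 1) (by omega)
  rw [xLab]
  split_ifs with h1 h2
  · simp
  · exfalso
    rcases Nat.lt_or_eq_of_le (numBefore_le (d := d) (p := p) (j := A + 1) (a := A + 1)) with h3 | h3
    · have h4 := h.diag _ h3 A hA
      have h5 := h.row _ h3 (A + 1) hA
      have := h.pos _ h3 (A + 1) hA (by omega)
      have := le_of_lt_numBefore hlt h3 le_rfl
      omega
    · rw [h3, h.last _ hA] at h2
      omega
  · simp

theorem isLabeling : IsLabeling n (arrayLab d M p) where
  up a b hab := by
    obtain ⟨x, hx, -⟩ := h.exists_horiz (A := a + b) (a := a) (by omega)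
    simp only [arrayLab]
    rwa [← hx.horiz_eq]
  down a b hab := by
    obtain ⟨x, hx, hx'⟩ := h.exists_horiz (A := a + b + 1) (a := a) (by omega)
    have e : a + 1 + b = a + b + 1 := by omega
    simp only [arrayLab, ← add_assoc, e]
    rwa [← hx.horiz_eq]
  ne a b hab := by
    simp only [arrayLab, hab, wLab]
    split_ifs with h1 h2
    · simp
    -- On line `n` every token is a `one`, since `M u n = d - u`.
    · obtain ⟨u, hu, rfl⟩ := h2
      exact absurd ⟨u, hu, rfl, by rw [h.finish u hu.le, h.finish (u + 1) hu]; omega⟩ h1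
    · simp
  nw b hb := by
    simp only [arrayLab]
    rw [xLab_of_not_mid (fun u _ h3 => by omega)]
    split_ifs <;> simp
  south a ha := by
    obtain ⟨x, hx, hx'⟩ := h.exists_horiz (A := a) (a := a) ha
    have h1 := h.wLab_ne_one ha.le le_rfl
    have h2 := h.xLab_last ha
    simp only [arrayLab, add_zero]
    rw [← hx.horiz_eq]
    -- The triangle just below the south side has no `one` on its two slanted edges, so its
    -- horizontal edge is `zero`, or it is `one` with backslash label `mid`.
    rcases hx' with H | H | H | H | H | H <;> simp_all

/-- The nonzero positions are not changed after they have left the triangle. -/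
theorem const_of_le {u a : ℕ} (hu : u < d) (ha : a < n) : p u a = a ↔ p u 0 = a := by
  constructor
  · intro hp
    have : ∀ k ≤ a, p u (a - k) = a := by
      intro k
      induction k with
      | zero => exact fun _ => hp
      | succ k ih =>
        intro hk
        have h1 := ih (by omega)
        have h2 := h.step u hu (a - (k + 1)) (by omega)
        rw [show a - (k + 1) + 1 = a - k by omega] at h2
        -- A move would make the token a `one` on line `a - k`, hence by `pos` in a position below
        -- `a - k`; but it is in position `a`.
        rcases h2 with h2 | ⟨h2, h3⟩
        · omega
        · have h4 := h.row u hu (a - k) (by omega)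
          have h5 := h.col u hu.le (a - (k + 1)) (by omega)
          rw [show a - (k + 1) + 1 = a - k by omega] at h5
          have := h.pos u hu (a - k) (by omega) (by omega)
          omega
    simpa using this a le_rfl
  · intro hp
    have : ∀ k ≤ a, p u k = a := by
      intro k
      induction k with
      | zero => exact fun _ => hp
      | succ k ih =>
        intro hk
        have h1 := ih (by omega)
        rcases h.step u hu k (by omega) with h2 | ⟨h2, h3⟩
        · omega
        · have h4 := h.row u hu k (by omega)
          have h5 := h.col (u + 1) hu k (by omega)
          have := h.pos u hu k (by omega) (by omega)
          omega
    exact this a le_rfl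

/-- The labels on the northeast side. -/
theorem arrayLab_ne {a b : ℕ} (hab : a + b + 1 = n) :
    arrayLab d M p (.backslash a b) = .one ↔ ∃ i : Fin d, a + lam i = n - d + i := by
  simp only [arrayLab, hab, wLab]
  have h0 : (∃ u < d, p u n = a ∧ M u n = M (u + 1) n + 1) ↔ ∃ i : Fin d, a + lam i = n - d + i := by
    constructor
    · rintro ⟨u, hu, rfl, -⟩
      exact ⟨⟨u, hu⟩, h.top ⟨u, hu⟩⟩
    · rintro ⟨i, hi⟩
      have := h.top i
      refine ⟨i, i.2, by omega, ?_⟩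
      have := i.2
      rw [h.finish i i.2.le, h.finish (i + 1) i.2]; omega
  rw [← h0]
  split_ifs with h1 h2 <;> simp [h1]

/-- The labels on the northwest side. -/
theorem arrayLab_nw {b : ℕ} (hb : b < n) :
    arrayLab d M p (.slash 0 b) = .one ↔ ∃ i : Fin d, b + mu i = n - d + i := by
  have h0 : numBefore d p (b + 1) 0 = 0 := by simp [numBefore]
  have hc := h.col 0 (Nat.zero_le d) b hb
  have h1 : M 0 (b + 1) = M 0 b + 1 ↔ ∃ i : Fin d, b + mu i = n - d + i := by
    constructor
    · intro h1
      have hMd : ∀ A ≤ n, M 0 A ≤ d := by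
        intro A hA
        have : ∀ k ≤ d, M (d - k) A ≤ k := by
          intro k
          induction k with
          | zero => simp [h.last A hA]
          | succ k ih =>
            intro hk
            have h2 := ih (by omega)
            have h3 := h.row (d - (k + 1)) (by omega) A hA
            rw [show d - (k + 1) + 1 = d - k by omega] at h3
            omega
        simpa using this d le_rfl
      have h2 := hMd (b + 1) hb
      -- Exactly `M 0 b` ones precede position `b`, so this is the index of the one found there.
      have h3 := h.first ⟨M 0 b, by omega⟩ b hb.le
      have h4 := h.first ⟨M 0 b, by omega⟩ (b + 1) hb
      simp only at h3 h4
      exact ⟨⟨M 0 b, by omega⟩, by simp only; omega⟩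
    · rintro ⟨i, hi⟩
      have h3 := h.first i b hb.le
      have h4 := h.first i (b + 1) hb
      omega
  rw [← h1]
  simp only [arrayLab, zero_add]
  rw [xLab_of_not_mid (fun u _ h3 => by omega), h0]
  split_ifs with h2 <;> simp [h2]

/-- The labels on the south side. -/
theorem arrayLab_south {a : ℕ} (ha : a < n) :
    arrayLab d M p (.horiz a 0) = .one ↔ ∃ i : Fin d, a + nu i = n - d + i := by
  obtain ⟨x, hx, hx'⟩ := h.exists_horiz (A := a) (a := a) ha
  have h1 := h.wLab_ne_one ha.le le_rfl
  -- Position `a` of line `a` is just below the south edge number `a`. Tokens found there no longer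
  -- move, so they can be compared with line `0`.
  have h2 : wLab d M p a a ≠ .zero ↔ ∃ i : Fin d, a + nu i = n - d + i := by
    constructor
    · intro h2
      by_contra hc
      push Not at hc
      refine h2 (wLab_of_ne fun u hu h3 => hc ⟨u, hu⟩ ?_)
      have := h.bot ⟨u, hu⟩
      rw [(h.const_of_le hu ha).1 h3] at this
      exact this
    · rintro ⟨i, hi⟩
      have h3 := h.bot i
      have h4 := (h.const_of_le i.2 ha).2 (by omega)
      have := h.wLab_of_eq (j := a) ha.le i.2
      rw [h4] at this
      rcases this with h5 | h5 <;> simp [h5.1]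
  rw [← h2]
  simp only [arrayLab, add_zero]
  rw [← hx.horiz_eq]
  rcases hx' with H | H | H | H | H | H <;> simp_all

/-- Every pair of arrays comes from a puzzle. -/
theorem exists_puzzle (hdn : d ≤ n) (hlam : lam ∈ boxPartitions d n) (hmu : mu ∈ boxPartitions d n)
    (hnu : nu ∈ boxPartitions d n) :
    ∃ P ∈ puzzles d n lam mu nu, P.Fits (arrayLab d M p) := by
  obtain ⟨P, hP⟩ := h.isLabeling.exists_puzzle
  refine ⟨P, ⟨?_, ?_, ?_⟩, hP⟩
  · rw [hasPartition_iff hdn hlam]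
    intro a
    have := a.2
    rw [← h.arrayLab_ne (a := a) (b := n - 1 - a) (by omega), Puzzle.wordNE]
    exact hP.label_eq_one_iff (t := .up a (n - 1 - a))
      (by simp only [UnitTriangle.Inside]; omega) (by simp [UnitTriangle.edges])
  · rw [hasPartition_iff hdn hmu]
    intro a
    have := a.2
    rw [← h.arrayLab_nw a.2, Puzzle.wordNW]
    exact hP.label_eq_one_iff (t := .up 0 a)
      (by simp only [UnitTriangle.Inside]; omega) (by simp [UnitTriangle.edges])
  · rw [hasPartition_iff hdn hnu]
    intro a
    have := a.2
    rw [← h.arrayLab_south a.2, Puzzle.wordS]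
    exact hP.label_eq_one_iff (t := .up a 0)
      (by simp only [UnitTriangle.Inside]; omega) (by simp [UnitTriangle.edges])

end IsArray


/-! ### From labelings to pairs of arrays -/

/-- A labeling of a square that extends a labeling of the triangle: `W j a` is the label in position
`a` of the line `x + y = j`, and `X A a` is the label of the slash edge in position `a` between
the lines `A` and `A + 1`. -/
structure IsSquare (n : ℕ) (W X : ℕ → ℕ → Lab) : Prop where
  step : ∀ A < n, ∀ a < n, ∃ x, UpOK (X A a) (W (A + 1) a) x ∧ DownOK (W A a) x (X A (a + 1))
  left : ∀ A < n, X A 0 ≠ .mid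
  right : ∀ A < n, X A n = .zero
  low : ∀ j ≤ n, ∀ a < n, j ≤ a → W j a ≠ .one
  top : ∀ a < n, W n a = .zero ∨ W n a = .one

/-- Gluing two triangles along their horizontal edge `x` and eliminating `x` leaves ten transfer
rules for a strip: four for each of the labels `zero` and `one` of `x`, and one for each of `mid`
and `eqv`. -/
theorem step_cases {s o i t x : Lab} (hu : UpOK s o x) (hd : DownOK i x t) :
    (s = .zero ∧ o = .zero ∧ i = .zero ∧ t = .zero) ∨
    (s = .zero ∧ o = .zero ∧ i = .one ∧ t = .mid) ∨
    (s = .zero ∧ o = .mid ∧ i = .one ∧ t = .one) ∨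
    (s = .zero ∧ o = .mid ∧ i = .mid ∧ t = .zero) ∨
    (s = .zero ∧ o = .one ∧ i = .one ∧ t = .zero) ∨
    (s = .one ∧ o = .one ∧ i = .one ∧ t = .one) ∨
    (s = .one ∧ o = .one ∧ i = .mid ∧ t = .zero) ∨
    (s = .one ∧ o = .zero ∧ i = .zero ∧ t = .one) ∨
    (s = .mid ∧ o = .one ∧ i = .zero ∧ t = .zero) ∨
    (s = .mid ∧ o = .one ∧ i = .one ∧ t = .mid) := by
  rcases hu with H | H | H | H | H | H <;> obtain ⟨rfl, rfl, rfl⟩ := H <;>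
    rcases hd with H | H | H | H | H | H <;> obtain ⟨rfl, H, rfl⟩ := H <;> simp_all

/-- The positions of the nonzero labels after `k` lines. -/
def tok (n : ℕ) (X : ℕ → ℕ → Lab) (q : ℕ → ℕ) : ℕ → ℕ → ℕ
  | 0, u => q u
  | k + 1, u => if X (n - 1 - k) (tok n X q k u) = .mid then tok n X q k u - 1 else tok n X q k u

/-- The number of labels `one` on a line among the nonzero labels from number `u` on. -/
def numOnes (d : ℕ) (W : ℕ → ℕ → Lab) (p : ℕ → ℕ → ℕ) (u j : ℕ) : ℕ :=
  ((Finset.Ico u d).filter (fun v => W j (p v j) = .one)).card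

theorem numOnes_last {d : ℕ} {W : ℕ → ℕ → Lab} {p : ℕ → ℕ → ℕ} {j : ℕ} : numOnes d W p d j = 0 := by
  simp [numOnes]

theorem numOnes_succ {d : ℕ} {W : ℕ → ℕ → Lab} {p : ℕ → ℕ → ℕ} {u j : ℕ} (hu : u < d) :
    numOnes d W p u j = numOnes d W p (u + 1) j + if W j (p u j) = .one then 1 else 0 := by
  rw [numOnes, numOnes, ← Finset.insert_Ico_add_one_left_eq_Ico hu, Finset.filter_insert]
  split_ifs with h
  · rw [Finset.card_insert_of_notMem (by simp)]
  · simp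

/-- A family of positions that moves according to the labels of a square. -/
structure Follows (d n : ℕ) (W X : ℕ → ℕ → Lab) (p : ℕ → ℕ → ℕ) : Prop where
  top_lt : ∀ u, u + 1 < d → p u n < p (u + 1) n
  top_lt_n : ∀ u < d, p u n < n
  top_iff : ∀ a < n, W n a ≠ .zero ↔ ∃ u < d, p u n = a
  move : ∀ u, ∀ A < n, p u A = if X A (p u (A + 1)) = .mid then p u (A + 1) - 1 else p u (A + 1)

namespace Follows

variable {d n : ℕ} {W X : ℕ → ℕ → Lab} {p : ℕ → ℕ → ℕ}

/-- Induction starts from the northeast side because `move` describes line `A` in terms of line `A +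
1`. -/
theorem aux (F : Follows d n W X p) (S : IsSquare n W X) (k : ℕ) (hk : k ≤ n) :
    (∀ u, u + 1 < d → p u (n - k) < p (u + 1) (n - k)) ∧ (∀ u < d, p u (n - k) < n) ∧
      ∀ a < n, W (n - k) a ≠ .zero ↔ ∃ u < d, p u (n - k) = a := by
  induction k with
  | zero => exact ⟨F.top_lt, F.top_lt_n, F.top_iff⟩
  | succ k ih =>
    obtain ⟨h1, h2, h3⟩ := ih (by omega)
    obtain ⟨A, hA⟩ : ∃ A, A = n - (k + 1) := ⟨_, rfl⟩
    have hA' : n - k = A + 1 := by omega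
    have hAn : A < n := by omega
    rw [hA'] at h1 h2 h3
    rw [← hA]
    have hmv := fun u => F.move u A hAn
    refine ⟨fun u hu => ?_, fun u hu => ?_, fun a ha => ?_⟩
    · have h4 := h1 u hu
      rw [hmv u, hmv (u + 1)]
      split_ifs with h5 h6 h6
      · have : p u (A + 1) ≠ 0 := fun h0 => S.left A hAn (h0 ▸ h5)
        omega
      · omega
      -- Right of a nonzero outer label, a slash label `mid` forces `mid` on the left side too. So
      -- if the next token steps left from the adjacent position, this one must have moved as well.
      · by_contra hc
        have h7 : p (u + 1) (A + 1) = p u (A + 1) + 1 := by omega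
        obtain ⟨x, hx, hx'⟩ := S.step A hAn _ (h2 u (by omega))
        rw [h7] at h6
        have h8 := (h3 _ (h2 u (by omega))).2 ⟨u, by omega, rfl⟩
        have := step_cases hx hx'
        rw [h6] at this
        simp_all
      · exact h4
    · have := h2 u hu
      rw [hmv u]
      split_ifs <;> omega
    · obtain ⟨x, hx, hx'⟩ := S.step A hAn a ha
      have key := step_cases hx hx'
      -- An inner position is occupied by a token that stays or by one that arrives from the right.
      have key2 : W A a ≠ .zero ↔
          (W (A + 1) a ≠ .zero ∧ X A a ≠ .mid) ∨ X A (a + 1) = .mid := by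
        rcases key with H | H | H | H | H | H | H | H | H | H <;> simp [H]
      rw [key2, h3 a ha]
      constructor
      · rintro (⟨⟨u, hu, rfl⟩, h5⟩ | h5)
        · exact ⟨u, hu, by rw [hmv, if_neg h5]⟩
        · have ha' : a + 1 < n := by
            by_contra hc
            have : a + 1 = n := by omega
            rw [this, S.right A hAn] at h5
            simp at h5
          obtain ⟨y, hy, hy'⟩ := S.step A hAn (a + 1) ha'
          have : W (A + 1) (a + 1) ≠ .zero := by
            rcases step_cases hy hy' with H | H | H | H | H | H | H | H | H | H <;> simp_all
          obtain ⟨u, hu, hu'⟩ := (h3 _ ha').1 this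
          exact ⟨u, hu, by rw [hmv, hu', if_pos h5]; rfl⟩
      · rintro ⟨u, hu, hu'⟩
        rw [hmv] at hu'
        split_ifs at hu' with h5
        · have : p u (A + 1) ≠ 0 := fun h0 => S.left A hAn (h0 ▸ h5)
          right
          rwa [show a + 1 = p u (A + 1) by omega]
        · left
          exact ⟨⟨u, hu, hu'⟩, hu' ▸ h5⟩

variable (F : Follows d n W X p) (S : IsSquare n W X)
include F S

theorem lt_succ {j : ℕ} (hj : j ≤ n) (u : ℕ) (hu : u + 1 < d) : p u j < p (u + 1) j := by
  have := (F.aux S (n - j) (by omega)).1 u hu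
  rwa [Nat.sub_sub_self hj] at this

theorem lt_n {j u : ℕ} (hj : j ≤ n) (hu : u < d) : p u j < n := by
  have := (F.aux S (n - j) (by omega)).2.1 u hu
  rwa [Nat.sub_sub_self hj] at this

theorem ne_zero_iff {j a : ℕ} (hj : j ≤ n) (ha : a < n) :
    W j a ≠ .zero ↔ ∃ u < d, p u j = a := by
  have := (F.aux S (n - j) (by omega)).2.2 a ha
  rwa [Nat.sub_sub_self hj] at this

theorem lt_of_lt {j : ℕ} (hj : j ≤ n) : ∀ v w, v < w → w < d → p v j < p w j := by
  intro v w hvw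
  induction w, hvw using Nat.le_induction with
  | base => exact fun hw => F.lt_succ S hj v hw
  | succ w _ ih => exact fun hw => (ih (by omega)).trans (F.lt_succ S hj w hw)

theorem move_pos {u A : ℕ} (hA : A < n) (hx : X A (p u (A + 1)) = .mid) :
    p u A + 1 = p u (A + 1) := by
  have : p u (A + 1) ≠ 0 := fun h0 => S.left A hA (h0 ▸ hx)
  rw [F.move u A hA, if_pos hx]
  omega

theorem inner_one {u A : ℕ} (hA : A < n) (hu : u < d) (hx : X A (p u (A + 1)) = .mid) :
    W A (p u A) = .one := by
  have h1 := F.move_pos S hA hx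
  obtain ⟨y, hy, hy'⟩ := S.step A hA (p u A) (F.lt_n S hA.le hu)
  rw [h1, hx] at hy'
  rcases step_cases hy hy' with H | H | H | H | H | H | H | H | H | H <;> simp_all

/-- Conservation of the labels `one`. -/
theorem numOnes_add {A : ℕ} (hA : A < n) (k : ℕ) (hk : k ≤ n) :
    numOnes d W p (numBefore d p (A + 1) (n - k)) (A + 1) =
      numOnes d W p (numBefore d p (A + 1) (n - k)) A +
        if X A (n - k) = .one then 1 else 0 := by
  have hlt := F.lt_of_lt S (j := A + 1) hA
  -- The count proceeds from the right end of the strip, where the slash label is `zero` and no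
  -- token is left. Each transfer rule preserves the balance; a token that moves is a `one` on both
  -- lines.
  induction k with
  | zero =>
    rw [Nat.sub_zero, S.right A hA, numBefore_all fun u hu => F.lt_n S hA hu]
    simp [numOnes_last]
  | succ k ih =>
    obtain ⟨a, ha⟩ : ∃ a, a = n - (k + 1) := ⟨_, rfl⟩
    have h1 := ih (by omega)
    rw [show n - k = a + 1 by omega] at h1
    rw [← ha]
    obtain ⟨x, hx, hx'⟩ := S.step A hA a (by omega)
    have key := step_cases hx hx'
    by_cases h2 : ∃ u < d, p u (A + 1) = a
    · obtain ⟨u, hu, rfl⟩ := h2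
      rw [numBefore_succ_self hlt hu] at h1
      rw [numBefore_self hlt hu, numOnes_succ hu, numOnes_succ hu, h1]
      have hne := (F.ne_zero_iff S hA (F.lt_n S hA hu)).2 ⟨u, hu, rfl⟩
      by_cases hm : X A (p u (A + 1)) = .mid
      · rw [F.inner_one S hA hu hm]
        rcases key with H | H | H | H | H | H | H | H | H | H <;> simp_all
      · have := F.move u A hA
        rw [if_neg hm] at this
        rw [this]
        rcases key with H | H | H | H | H | H | H | H | H | H <;> simp_all
    · have hz : W (A + 1) a = .zero := by
        by_contra hc
        exact h2 ((F.ne_zero_iff S hA (by omega)).1 hc)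
      push Not at h2
      rw [numBefore_succ_of_forall_ne h2] at h1
      rw [h1]
      rcases key with H | H | H | H | H | H | H | H | H | H <;> simp_all

theorem numOnes_step {u A : ℕ} (hA : A < n) (hu : u < d) :
    numOnes d W p u (A + 1) = numOnes d W p u A +
        if X A (p u (A + 1)) = .one then 1 else 0 := by
  have h2 := F.lt_n S (j := A + 1) hA hu
  have := F.numOnes_add S hA (n - p u (A + 1)) (by omega)
  rwa [Nat.sub_sub_self h2.le, numBefore_self (F.lt_of_lt S (j := A + 1) hA) hu] at this

theorem numOnes_step_succ {u A : ℕ} (hA : A < n) (hu : u < d) :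
    numOnes d W p (u + 1) (A + 1) = numOnes d W p (u + 1) A +
        if X A (p u (A + 1) + 1) = .one then 1 else 0 := by
  have h2 := F.lt_n S (j := A + 1) hA hu
  have := F.numOnes_add S hA (n - (p u (A + 1) + 1)) (by omega)
  rwa [Nat.sub_sub_self h2, numBefore_succ_self (F.lt_of_lt S (j := A + 1) hA) hu] at this

theorem numOnes_first {A : ℕ} (hA : A < n) :
    numOnes d W p 0 (A + 1) = numOnes d W p 0 A + if X A 0 = .one then 1 else 0 := by
  have := F.numOnes_add S hA n le_rfl
  rwa [Nat.sub_self, show numBefore d p (A + 1) 0 = 0 by simp [numBefore]] at this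

/-- The two alternatives of `IsArray.step`; their statements about the slash edge to the right give
`diag` and the value of `M` at a move. -/
theorem step_token {u A : ℕ} (hA : A < n) (hu : u < d) :
    (X A (p u (A + 1)) = .mid ∧ p u A + 1 = p u (A + 1) ∧ W (A + 1) (p u (A + 1)) = .one ∧
      W A (p u A) = .one ∧ X A (p u (A + 1) + 1) ≠ .one) ∨
    (X A (p u (A + 1)) ≠ .mid ∧ p u A = p u (A + 1) ∧
      (X A (p u (A + 1) + 1) = .one → W A (p u A) = .one)) := by
  have h2 := F.lt_n S (j := A + 1) hA hu
  obtain ⟨x, hx, hx'⟩ := S.step A hA _ h2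
  have key := step_cases hx hx'
  have hne := (F.ne_zero_iff S hA h2).2 ⟨u, hu, rfl⟩
  by_cases hm : X A (p u (A + 1)) = .mid
  · left
    refine ⟨hm, F.move_pos S hA hm, ?_, F.inner_one S hA hu hm, ?_⟩ <;>
    rcases key with H | H | H | H | H | H | H | H | H | H <;> simp_all
  · right
    have := F.move u A hA
    rw [if_neg hm] at this
    refine ⟨hm, this, ?_⟩
    rw [this]
    rcases key with H | H | H | H | H | H | H | H | H | H <;> simp_all

theorem isArray {lam mu nu : Fin d → ℕ} (hmu : mu ∈ boxPartitions d n)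
    (hnu : nu ∈ boxPartitions d n)
    (htop : ∀ i : Fin d, p i n + lam i = n - d + i)
    (hleft : ∀ A < n, X A 0 = .one ↔ ∃ i : Fin d, A + mu i = n - d + i)
    (hbot : ∀ a < n, W 0 a ≠ .zero ↔ ∃ i : Fin d, a + nu i = n - d + i) :
    IsArray d n lam mu nu (numOnes d W p) p where
  last j _ := numOnes_last
  start u hu := by
    rw [numOnes, Finset.card_eq_zero, Finset.filter_eq_empty_iff]
    intro v hv
    rw [Finset.mem_Ico] at hv
    exact S.low 0 (Nat.zero_le n) _ (F.lt_n S (Nat.zero_le n) hv.2) (Nat.zero_le _)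
  finish u hu := by
    rw [numOnes, Finset.filter_true_of_mem]
    · simp
    · intro v hv
      rw [Finset.mem_Ico] at hv
      have h1 := F.lt_n S le_rfl hv.2
      have h2 := (F.ne_zero_iff S le_rfl h1).2 ⟨v, hv.2, rfl⟩
      rcases S.top _ h1 with h3 | h3
      · exact absurd h3 h2
      · exact h3
  row u hu j hj := by
    rw [numOnes_succ hu]
    split_ifs <;> omega
  col u hu A hA := by
    rcases Nat.lt_or_eq_of_le hu with hu | rfl
    · rw [F.numOnes_step S hA hu]
      split_ifs <;> omega
    · simp [numOnes_last]
  diag u hu A hA := by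
    rw [F.numOnes_step_succ S hA hu, numOnes_succ hu]
    rcases F.step_token S hA hu with H | H <;> split_ifs <;> simp_all
  first := by
    -- The flux through the northwest side raises `M 0` exactly at the ones of the word of `mu`,
    -- which have distinct positions.
    have hM : ∀ A ≤ n, numOnes d W p 0 A =
        (Finset.univ.filter (fun i : Fin d => n - d + i < A + mu i)).card := by
      intro A
      induction A with
      | zero =>
        intro _
        have h0 : numOnes d W p 0 0 = 0 := by
          rw [numOnes, Finset.card_eq_zero, Finset.filter_eq_empty_iff]
          intro v hv
          rw [Finset.mem_Ico] at hv
          exact S.low 0 (Nat.zero_le n) _ (F.lt_n S (Nat.zero_le n) hv.2) (Nat.zero_le _)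
        rw [h0, eq_comm, Finset.card_eq_zero, Finset.filter_eq_empty_iff]
        intro i _
        have := hmu.2 i
        omega
      | succ A ih =>
        intro hA
        rw [F.numOnes_first S hA, ih (by omega)]
        by_cases h1 : ∃ i : Fin d, A + mu i = n - d + i
        · rw [if_pos ((hleft A hA).2 h1)]
          obtain ⟨i, hi⟩ := h1
          have : Finset.univ.filter (fun k : Fin d => n - d + k < A + 1 + mu k) =
              insert i (Finset.univ.filter (fun k : Fin d => n - d + k < A + mu k)) := by
            ext k
            simp only [Finset.mem_filter, Finset.mem_univ, true_and, Finset.mem_insert]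
            constructor
            · intro hk
              rcases lt_trichotomy k i with h2 | h2 | h2
              · have := hmu.1 h2.le
                have : (k : ℕ) < i := h2
                omega
              · exact Or.inl h2
              · have := hmu.1 h2.le
                have : (i : ℕ) < k := h2
                omega
            · rintro (rfl | hk) <;> omega
          rw [this, Finset.card_insert_of_notMem]
          simp only [Finset.mem_filter, Finset.mem_univ, true_and]
          omega
        · rw [if_neg (fun h2 => h1 ((hleft A hA).1 h2)), add_zero]
          congr 1
          ext k
          simp only [Finset.mem_filter, Finset.mem_univ, true_and]
          push Not at h1
          have := h1 k
          omega
    intro i A hA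
    rw [hM A hA]
    constructor
    · intro hi
      by_contra hc
      have : Finset.univ.filter (fun k : Fin d => n - d + k < A + mu k) ⊆ Finset.Iio i := by
        intro k hk
        simp only [Finset.mem_filter, Finset.mem_univ, true_and] at hk
        rw [Finset.mem_Iio]
        by_contra hki
        have := hmu.1 (not_lt.1 hki)
        have : (i : ℕ) ≤ k := not_lt.1 hki
        omega
      have := Finset.card_le_card this
      rw [Fin.card_Iio] at this
      omega
    · intro hi
      have : Finset.Iic i ⊆ Finset.univ.filter (fun k : Fin d => n - d + k < A + mu k) := by
        intro k hk
        rw [Finset.mem_Iic] at hk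
        simp only [Finset.mem_filter, Finset.mem_univ, true_and]
        have := hmu.1 hk
        have : (k : ℕ) ≤ i := hk
        omega
      have := Finset.card_le_card this
      rwa [Fin.card_Iic] at this
  step u hu A hA := by
    rcases F.step_token S hA hu with H | H
    · right
      refine ⟨H.2.1, ?_⟩
      rw [F.numOnes_step_succ S hA hu, numOnes_succ hu, if_pos H.2.2.2.1, if_neg H.2.2.2.2]
    · exact Or.inl H.2.1
  lt_succ u hu j hj := F.lt_succ S hj u hu
  top := htop
  bot i := by
    have hb := hnu.2
    -- Two strictly increasing sequences with the same range are equal.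
    have e : (fun i : Fin d => p i 0) = fun i : Fin d => n - d + i - nu i := by
      refine (StrictMono.range_inj ?_ ?_).1 ?_
      · intro i k hik
        exact F.lt_of_lt S (Nat.zero_le n) i k hik k.2
      · intro i k hik
        have := hnu.1 hik.le
        have : (i : ℕ) < k := hik
        have := hb i
        simp only
        omega
      · ext a
        simp only [Set.mem_range]
        constructor
        · rintro ⟨i, rfl⟩
          have h1 := F.lt_n S (Nat.zero_le n) i.2
          obtain ⟨k, hk⟩ := (hbot _ h1).1 ((F.ne_zero_iff S (Nat.zero_le n) h1).2 ⟨i, i.2, rfl⟩)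
          exact ⟨k, by omega⟩
        · rintro ⟨k, rfl⟩
          have := hb k
          have := k.2
          by_cases hdn : n - d + k - nu k < n
          · have h1 := (hbot _ hdn).2 ⟨k, by omega⟩
            obtain ⟨u, hu, hu'⟩ := (F.ne_zero_iff S (Nat.zero_le n) hdn).1 h1
            exact ⟨⟨u, hu⟩, hu'⟩
          -- This could only happen for `d > n`, which `d` strictly increasing positions below `n`
          -- exclude.
          · exfalso
            have h3 : ∀ u < d, u ≤ p u 0 := by
              intro u
              induction u with
              | zero => exact fun _ => Nat.zero_le _
              | succ u ih =>
                intro hu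
                have := ih (by omega)
                have := F.lt_succ S (Nat.zero_le n) u hu
                omega
            have h4 := h3 (d - 1) (by omega)
            have h5 := F.lt_n S (Nat.zero_le n) (u := d - 1) (by omega)
            omega
    have := congrFun e i
    have := hb i
    omega
  pos u hu j hj hM := by
    rw [numOnes_succ hu] at hM
    by_contra hc
    have := S.low j hj _ (F.lt_n S hj hu) (by omega)
    rw [if_neg this] at hM
    omega

/-- Together with `Follows.xLab_eq`: the arrays extracted from a labeling reproduce it. The label
`eqv` never occurs on backslash edges of a puzzle, which is the extra hypothesis. -/
theorem wLab_eq (S' : ∀ j ≤ n, ∀ a < n, W j a ≠ .eqv) {j a : ℕ} (hj : j ≤ n) (ha : a < n) :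
    wLab d (numOnes d W p) p j a = W j a := by
  have hlt := F.lt_of_lt S hj
  by_cases h1 : ∃ u < d, p u j = a
  · have hne := (F.ne_zero_iff S hj ha).2 h1
    obtain ⟨u, hu, rfl⟩ := h1
    have h2 := numOnes_succ (W := W) (p := p) (j := j) hu
    rw [wLab]
    split_ifs with h3 h4
    · obtain ⟨v, hv, h5, h6⟩ := h3
      rw [numOnes_succ hv, h5] at h6
      by_contra hc
      rw [if_neg (fun h => hc h.symm)] at h6
      omega
    · have := S' j hj _ ha
      have : W j (p u j) ≠ .one := by
        intro h5
        rw [if_pos h5] at h2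
        exact h3 ⟨u, hu, rfl, h2⟩
      generalize W j (p u j) = w at *
      cases w <;> simp_all
    · exact absurd ⟨u, hu, rfl⟩ h4
  · have hz : W j a = .zero := by
      by_contra hc
      exact h1 ((F.ne_zero_iff S hj ha).1 hc)
    push Not at h1
    rw [wLab_of_ne h1, hz]

theorem xLab_eq {A a : ℕ} (hA : A < n) (ha : a < n) :
    xLab d (numOnes d W p) p A a = X A a := by
  obtain ⟨x, hx, hx'⟩ := S.step A hA a ha
  have key := step_cases hx hx'
  rw [xLab]
  have h0 := F.numOnes_add S hA (n - a) (by omega)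
  rw [Nat.sub_sub_self ha.le] at h0
  split_ifs with h1 h2
  · obtain ⟨u, hu, rfl, h2⟩ := h1
    rcases F.step_token S hA hu with H | H
    · exact H.1.symm
    · omega
  · rw [h2] at h0
    by_contra hc
    rw [if_neg (fun h => hc h.symm)] at h0
    omega
  · have h3 : X A a ≠ .one := by
      intro h3
      rw [if_pos h3] at h0
      exact h2 h0
    have h4 : X A a ≠ .mid := by
      intro h4
      have h5 : W (A + 1) a ≠ .zero := by
        rcases key with H | H | H | H | H | H | H | H | H | H <;> simp_all
      obtain ⟨u, hu, rfl⟩ := (F.ne_zero_iff S hA ha).1 h5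
      exact h1 ⟨u, hu, rfl, F.move_pos S hA h4⟩
    rcases key with H | H | H | H | H | H | H | H | H | H <;> simp_all

end Follows

/-- The labels on the line `x + y = j`, extended by the labels on the south side. -/
def lineLab (l : Edge → Lab) (j a : ℕ) : Lab :=
  if a < j then l (.backslash a (j - 1 - a)) else if l (.horiz a 0) = .one then .mid else .zero

/-- The labels of the slash edges, extended by zero. -/
def slashLab (l : Edge → Lab) (A a : ℕ) : Lab :=
  if a ≤ A then l (.slash a (A - a)) else .zero

/-- Below a south edge labelled `one` hangs a column of slash rhombi, and elsewhere everything is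
`zero`: a token leaving the triangle becomes `mid` and keeps its position. -/
theorem IsLabeling.isSquare {n : ℕ} {l : Edge → Lab} (hl : IsLabeling n l) :
    IsSquare n (lineLab l) (slashLab l) where
  step A hA a ha := by
    rcases lt_trichotomy a A with h | h | h
    · refine ⟨l (.horiz a (A - a)), ?_, ?_⟩
      · have := hl.up a (A - a) (by omega)
        rw [slashLab, if_pos h.le, lineLab, if_pos (by omega)]
        simpa using this
      · have := hl.down a (A - 1 - a) (by omega)
        rw [slashLab, if_pos (by omega), lineLab, if_pos h]
        rwa [show A - 1 - a + 1 = A - a by omega, show A - 1 - a = A - (a + 1) by omega] at *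
    · subst h
      refine ⟨l (.horiz a 0), ?_, ?_⟩
      · have := hl.up a 0 (by omega)
        rw [slashLab, if_pos le_rfl, lineLab, if_pos (by omega)]
        simpa using this
      · have h1 := hl.south a ha
        rw [slashLab, if_neg (by omega), lineLab, if_neg (by omega)]
        generalize l (.horiz a 0) = x at *
        cases x <;> simp_all [DownOK]
    · rw [slashLab, if_neg h.not_ge, lineLab, if_neg (show ¬ a < A + 1 by omega), lineLab,
        if_neg (show ¬ a < A by omega), slashLab, if_neg (show ¬ a + 1 ≤ A by omega)]
      split_ifs
      · exact ⟨.one, by simp [UpOK], by simp [DownOK]⟩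
      · exact ⟨.zero, by simp [UpOK], by simp [DownOK]⟩
  left A hA := by
    rw [slashLab, if_pos (Nat.zero_le A)]
    exact hl.nw _ hA
  right A hA := by rw [slashLab, if_neg (by omega)]
  low j hj a ha hja := by
    rw [lineLab, if_neg (by omega)]
    split_ifs <;> simp
  top a ha := by
    rw [lineLab, if_pos ha]
    have h1 := hl.ne a (n - 1 - a) (by omega)
    have h2 := hl.up a (n - 1 - a) (by omega)
    rcases h2 with H | H | H | H | H | H <;> simp_all

/-- Every labeling with the right boundary comes from a pair of arrays. -/
theorem IsLabeling.exists_isArray {d n : ℕ} (hdn : d ≤ n) {lam mu nu : Fin d → ℕ}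
    (hlam : lam ∈ boxPartitions d n) (hmu : mu ∈ boxPartitions d n) (hnu : nu ∈ boxPartitions d n)
    {l : Edge → Lab} (hl : IsLabeling n l)
    (hne : ∀ a < n, l (.backslash a (n - 1 - a)) = .one ↔ ∃ i : Fin d, a + lam i = n - d + i)
    (hnw : ∀ b < n, l (.slash 0 b) = .one ↔ ∃ i : Fin d, b + mu i = n - d + i)
    (hs : ∀ a < n, l (.horiz a 0) = .one ↔ ∃ i : Fin d, a + nu i = n - d + i) :
    ∃ M p, IsArray d n lam mu nu M p ∧ ∀ t : UnitTriangle, t.Inside n → ∀ e ∈ t.edges,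
      l e = arrayLab d M p e := by
  have S := hl.isSquare
  -- The starting positions on the northeast side are the ones of the word of `lam`.
  let q : ℕ → ℕ := fun u => if h : u < d then n - d + u - lam ⟨u, h⟩ else 0
  let p : ℕ → ℕ → ℕ := fun u j => tok n (slashLab l) q (n - j) u
  have hle := hlam.2
  have hpn : ∀ u (hu : u < d), p u n + lam ⟨u, hu⟩ = n - d + u := by
    intro u hu
    simp only [p, Nat.sub_self, tok, q, hu, ↓reduceDIte]
    have := hle ⟨u, hu⟩
    omega
  have F : Follows d n (lineLab l) (slashLab l) p := by
    refine ⟨?_, ?_, ?_, ?_⟩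
    · intro u hu
      have h1 := hpn u (by omega)
      have h2 := hpn (u + 1) hu
      have : lam ⟨u + 1, hu⟩ ≤ lam ⟨u, by omega⟩ := hlam.1 (by simp)
      omega
    · intro u hu
      have := hpn u hu
      omega
    · intro a ha
      have h1 := S.top a ha
      have h2 : lineLab l n a ≠ .zero ↔ lineLab l n a = .one := by
        rcases h1 with h1 | h1 <;> simp [h1]
      rw [h2, lineLab, if_pos ha, hne a ha]
      constructor
      · rintro ⟨i, hi⟩
        exact ⟨i, i.2, by have := hpn i i.2; simp only [Fin.eta] at this; omega⟩
      · rintro ⟨u, hu, rfl⟩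
        exact ⟨⟨u, hu⟩, hpn u hu⟩
    · intro u A hA
      simp only [p]
      rw [show n - A = (n - (A + 1)) + 1 by omega, tok, show n - 1 - (n - (A + 1)) = A by omega]
  have hW : ∀ j ≤ n, ∀ a < n, lineLab l j a ≠ .eqv := by
    intro j hj a ha
    rw [lineLab]
    split_ifs
    · have h2 := hl.up a (j - 1 - a) (by omega)
      rcases h2 with H | H | H | H | H | H <;> simp_all
    · simp
    · simp
  refine ⟨_, p, F.isArray S hmu hnu (fun i => hpn i i.2) ?_ ?_, ?_⟩
  · intro A hA
    rw [slashLab, if_pos (Nat.zero_le A)]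
    exact hnw A hA
  · intro a ha
    rw [lineLab, if_neg (by omega), ← hs a ha]
    split_ifs with h <;> simp [h]
  · have hbs : ∀ a b, a + b + 1 ≤ n → l (.backslash a b) =
        arrayLab d (numOnes d (lineLab l) p) p (.backslash a b) := by
      intro a b hab
      rw [arrayLab, F.wLab_eq S hW hab (by omega), lineLab, if_pos (by omega)]
      congr 2; omega
    have hsl : ∀ a b, a + b + 1 ≤ n → l (.slash a b) =
        arrayLab d (numOnes d (lineLab l) p) p (.slash a b) := by
      intro a b hab
      rw [arrayLab, F.xLab_eq S (by omega) (by omega), slashLab, if_pos (by omega)]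
      congr 2; omega
    have hho : ∀ a b, a + b + 1 ≤ n → l (.horiz a b) =
        arrayLab d (numOnes d (lineLab l) p) p (.horiz a b) := by
      intro a b hab
      rw [(hl.up a b hab).horiz_eq, hbs a b hab, hsl a b hab]
      rfl
    intro t ht e he
    cases t <;> simp only [UnitTriangle.edges, List.mem_cons, List.not_mem_nil, or_false] at he <;>
      simp only [UnitTriangle.Inside] at ht <;> rcases he with rfl | rfl | rfl
    · exact hsl _ _ ht
    · exact hbs _ _ ht
    · exact hho _ _ ht
    · exact hbs _ _ (by omega)
    · exact hho _ _ (by omega)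
    · exact hsl _ _ (by omega)

/-- Every puzzle comes from a pair of arrays. -/
theorem Puzzle.exists_isArray {d n : ℕ} (hdn : d ≤ n) {lam mu nu : Fin d → ℕ}
    (hlam : lam ∈ boxPartitions d n) (hmu : mu ∈ boxPartitions d n) (hnu : nu ∈ boxPartitions d n)
    {P : Puzzle n} (hP : P ∈ puzzles d n lam mu nu) :
    ∃ M p, IsArray d n lam mu nu M p ∧ P.Fits (arrayLab d M p) := by
  obtain ⟨l, hl⟩ := P.exists_fits
  obtain ⟨h1, h2, h3⟩ := hP
  rw [hasPartition_iff hdn hlam] at h1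
  rw [hasPartition_iff hdn hmu] at h2
  rw [hasPartition_iff hdn hnu] at h3
  obtain ⟨M, p, hA, he⟩ := hl.isLabeling.exists_isArray hdn hlam hmu hnu
    (fun a ha => by
      rw [← h1 ⟨a, ha⟩, Puzzle.wordNE]
      exact (hl.label_eq_one_iff (t := .up a (n - 1 - a))
        (by simp only [UnitTriangle.Inside]; omega) (by simp [UnitTriangle.edges])).symm)
    (fun a ha => by
      rw [← h2 ⟨a, ha⟩, Puzzle.wordNW]
      exact (hl.label_eq_one_iff (t := .up 0 a)
        (by simp only [UnitTriangle.Inside]; omega) (by simp [UnitTriangle.edges])).symm)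
    (fun a ha => by
      rw [← h3 ⟨a, ha⟩, Puzzle.wordS]
      exact (hl.label_eq_one_iff (t := .up a 0)
        (by simp only [UnitTriangle.Inside]; omega) (by simp [UnitTriangle.edges])).symm)
  exact ⟨M, p, hA, hl.congr he⟩

/-- The arrays are determined by the labels inside the triangle. -/
theorem IsArray.eq_of_arrayLab {d n : ℕ} {lam mu nu : Fin d → ℕ} {M p M' p' : ℕ → ℕ → ℕ}
    (h : IsArray d n lam mu nu M p) (h' : IsArray d n lam mu nu M' p')
    (hl : ∀ t : UnitTriangle, t.Inside n → ∀ e ∈ t.edges,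
      arrayLab d M p e = arrayLab d M' p' e) :
    ∀ j ≤ n, (∀ u ≤ d, M u j = M' u j) ∧ ∀ u < d, p u j = p' u j := by
  have hx : ∀ A < n, ∀ a ≤ A, xLab d M p A a = xLab d M' p' A a := by
    intro A hA a ha
    have := hl (.up a (A - a)) (by simp only [UnitTriangle.Inside]; omega) (.slash a (A - a))
      (by simp [UnitTriangle.edges])
    simpa only [arrayLab, Nat.add_sub_cancel' ha] using this
  have hw : ∀ j ≤ n, ∀ a < j, wLab d M p j a = wLab d M' p' j a := by
    intro j hj a ha
    have := hl (.up a (j - 1 - a)) (by simp only [UnitTriangle.Inside]; omega)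
      (.backslash a (j - 1 - a)) (by simp [UnitTriangle.edges])
    simpa only [arrayLab, show a + (j - 1 - a) + 1 = j by omega] using this
  -- Moving tokens are ones, so by `pos` the edge labelled `mid` that witnesses a move lies inside
  -- the triangle.
  have hmove : ∀ {M p : ℕ → ℕ → ℕ}, IsArray d n lam mu nu M p → ∀ u < d, ∀ A < n,
      (p u A + 1 = p u (A + 1) ↔ p u (A + 1) ≤ A ∧ xLab d M p A (p u (A + 1)) = .mid) := by
    intro M p h u hu A hA
    constructor
    · intro h1
      have h2 := h.step u hu A hA
      have h3 := h.row u hu (A + 1) hA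
      have h4 := h.col u hu.le A hA
      have h5 := h.pos u hu (A + 1) hA (by omega)
      exact ⟨by omega, by rw [xLab, if_pos ⟨u, hu, rfl, h1⟩]⟩
    · rintro ⟨-, h2⟩
      rw [xLab] at h2
      split_ifs at h2 with h3
      obtain ⟨v, hv, h4, h5⟩ := h3
      obtain rfl := h.inj hA hv hu h4
      exact h5
  have hp : ∀ k ≤ n, ∀ u < d, p u (n - k) = p' u (n - k) := by
    intro k
    induction k with
    | zero =>
      intro _ u hu
      have h1 := h.top ⟨u, hu⟩
      have h2 := h'.top ⟨u, hu⟩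
      simp only [Nat.sub_zero] at h1 h2 ⊢
      omega
    | succ k ih =>
      intro hk u hu
      have h1 := ih (by omega) u hu
      obtain ⟨A, hA⟩ : ∃ A, A = n - (k + 1) := ⟨_, rfl⟩
      rw [show n - k = A + 1 by omega] at h1
      rw [← hA]
      have h2 := hmove h u hu A (by omega)
      have h3 := hmove h' u hu A (by omega)
      have h4 := h.step u hu A (by omega)
      have h5 := h'.step u hu A (by omega)
      have h6 : p u A + 1 = p u (A + 1) ↔ p' u A + 1 = p' u (A + 1) := by
        rw [h2, h3, ← h1]
        refine and_congr_right fun h6 => ?_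
        rw [hx A (by omega) _ h6]
      omega
  have hp' : ∀ j ≤ n, ∀ u < d, p u j = p' u j := by
    intro j hj u hu
    have := hp (n - j) (by omega) u hu
    rwa [Nat.sub_sub_self hj] at this
  intro j hj
  refine ⟨?_, hp' j hj⟩
  have hM : ∀ k ≤ d, M (d - k) j = M' (d - k) j := by
    intro k
    induction k with
    | zero => exact fun _ => by rw [Nat.sub_zero, h.last j hj, h'.last j hj]
    | succ k ih =>
      intro hk
      have h1 := ih (by omega)
      obtain ⟨u, hu⟩ : ∃ u, u = d - (k + 1) := ⟨_, rfl⟩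
      have hud : u < d := by omega
      rw [show d - k = u + 1 by omega] at h1
      rw [← hu]
      have h2 := h.row u hud j hj
      have h3 := h'.row u hud j hj
      have h4 := h.pos u hud j hj
      have h5 := h'.pos u hud j hj
      have h6 := hp' j hj u hud
      -- Inside the triangle the label tells whether token `u` is a `one`; outside, `pos` says that
      -- it is not.
      by_cases hlt : p u j < j
      · have h7 := h.wLab_of_eq hj hud
        have h8 := h'.wLab_of_eq hj hud
        rw [hw j hj _ hlt, h6] at h7
        rcases h7 with h7 | h7 <;> rcases h8 with h8 | h8
        · omega
        · simp [h7.1] at h8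
        · simp [h7.1] at h8
        · omega
      · omega
  intro u hu
  have := hM (d - u) (by omega)
  rwa [Nat.sub_sub_self hu] at this


/-! ### Tableaux of reverse shape as interlacing arrays -/

/-- The pair `(i, j)` is a box of the reverse Young diagram `mu`. -/
def InShape {d : ℕ} (mu : Fin d → ℕ) (i j : ℕ) : Prop := ∃ h : i < d, j < mu ⟨i, h⟩

theorem InShape.mono {d : ℕ} {mu : Fin d → ℕ} (hmu : Antitone mu) {i i' j j' : ℕ}
    (h : InShape mu i j) (hi : i' ≤ i) (hj : j' ≤ j) : InShape mu i' j' := by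
  obtain ⟨h1, h2⟩ := h
  have : mu ⟨i, h1⟩ ≤ mu ⟨i', by omega⟩ := hmu (by simpa using hi)
  exact ⟨by omega, by omega⟩

/-- Entries of `M` count initial segments of rows, so they are compared one row at a time through `i
+ 1 ≤ M u A`. -/
theorem le_of_forall_succ_le {a b : ℕ} (h : ∀ i, i + 1 ≤ a → i + 1 ≤ b) : a ≤ b := by
  rcases a with _ | a
  · omega
  · exact h a le_rfl

theorem le_succ_of_forall {a b : ℕ} (h : ∀ i, i + 2 ≤ a → i + 1 ≤ b) : a ≤ b + 1 := by
  rcases a with _ | _ | a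
  · omega
  · omega
  · have := h a le_rfl
    omega

theorem succ_le_card_filter_range {N : ℕ} {Q : ℕ → Prop} [DecidablePred Q]
    (hQ : ∀ i, i + 1 < N → Q (i + 1) → Q i) (i : ℕ) :
    i + 1 ≤ ((Finset.range N).filter Q).card ↔ i < N ∧ Q i := by
  have hdown : ∀ k i, i + k < N → Q (i + k) → Q i := by
    intro k
    induction k with
    | zero => exact fun i _ h => h
    | succ k ih => exact fun i hi h => ih i (by omega) (hQ (i + k) hi h)
  constructor
  · intro h
    by_contra hc
    have : (Finset.range N).filter Q ⊆ Finset.range i := by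
      intro k hk
      rw [Finset.mem_filter, Finset.mem_range] at hk
      rw [Finset.mem_range]
      by_contra hki
      refine hc ⟨by omega, hdown (k - i) i (by omega) ?_⟩
      rw [show i + (k - i) = k by omega]
      exact hk.2
    have := Finset.card_le_card this
    rw [Finset.card_range] at this
    omega
  · rintro ⟨h1, h2⟩
    have : Finset.range (i + 1) ⊆ (Finset.range N).filter Q := by
      intro k hk
      rw [Finset.mem_range] at hk
      rw [Finset.mem_filter, Finset.mem_range]
      refine ⟨by omega, hdown (i - k) k (by omega) ?_⟩
      rw [show k + (i - k) = i by omega]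
      exact h2
    have := Finset.card_le_card this
    rwa [Finset.card_range] at this

theorem card_filter_box {d : ℕ} {lam mu : Fin d → ℕ} (Q : Box lam mu → Prop) [DecidablePred Q] :
    (Finset.univ.filter Q).card = (Finset.univ.filter (fun c => Q (.inl c))).card +
      (Finset.univ.filter (fun c => Q (.inr c))).card := by
  simp only [Finset.card_filter, Fintype.sum_sum_type]

theorem card_row {d : ℕ} (lam : Fin d → ℕ) (k : Fin d) :
    (Finset.univ.filter (fun c : Σ i : Fin d, Fin (lam i) => c.1 = k)).card = lam k := by
  rw [Finset.card_filter, Fintype.sum_sigma, Finset.sum_eq_single k]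
  · simp
  · intro i _ hi
    simp [hi]
  · simp

namespace SkewBarredTableau

variable {d n : ℕ} {lam mu : Fin d → ℕ} (L : SkewBarredTableau lam mu)

/-- The value in the box `(i, j)` of `mu`, decreased by one. -/
noncomputable def entry (i j : ℕ) : ℕ :=
  open Classical in
  if h : InShape mu i j then L.val (.inr ⟨⟨i, h.1⟩, ⟨j, h.2⟩⟩) else 0

theorem entry_eq (c : Σ i : Fin d, Fin (mu i)) : L.entry c.1 c.2 = L.val (.inr c) := by
  rw [entry, dif_pos ⟨c.1.2, c.2.2⟩]

theorem inShape (c : Σ i : Fin d, Fin (mu i)) : InShape mu c.1 c.2 := ⟨c.1.2, c.2.2⟩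

theorem entry_row {i j j' : ℕ} (h : InShape mu i j) (hj : j' ≤ j) :
    L.entry i j ≤ L.entry i j' := by
  have h' : InShape mu i j' := ⟨h.1, hj.trans_lt h.2⟩
  rw [entry, dif_pos h, entry, dif_pos h']
  rcases Nat.lt_or_eq_of_le hj with hj | rfl
  · refine L.row_weak _ _ (by simp [Box.y]) ?_
    simp only [Box.x]
    omega
  · exact le_rfl

theorem entry_col (hmu : Antitone mu) {i j : ℕ} (h : InShape mu (i + 1) j) :
    L.entry (i + 1) j < L.entry i j := by
  have h' : InShape mu i j := h.mono hmu (by omega) le_rfl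
  rw [entry, dif_pos h, entry, dif_pos h']
  refine L.col_strict _ _ (by simp [Box.x]) ?_
  simp [Box.y]

theorem entry_col_add (hmu : Antitone mu) {i j : ℕ} (k : ℕ) (h : InShape mu (i + k) j) :
    L.entry (i + k) j + k ≤ L.entry i j := by
  induction k with
  | zero => simp
  | succ k ih =>
    have h1 := ih (h.mono hmu (by omega) le_rfl)
    have h2 : L.entry (i + (k + 1)) j < L.entry (i + k) j := L.entry_col hmu h
    omega

/-- The `i` boxes below, in the same column, carry strictly increasing larger values, all less than
`d`. -/
theorem entry_add_lt (hmu : Antitone mu) {i j : ℕ} (h : InShape mu i j) :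
    i + L.entry i j < d := by
  have h0 : InShape mu 0 j := h.mono hmu (Nat.zero_le _) le_rfl
  have h1 := L.entry_col_add hmu (i := 0) (j := j) i (by simpa using h)
  have h2 : L.entry 0 j < d := by rw [entry, dif_pos h0]; exact Fin.is_lt _
  rw [zero_add] at h1
  omega

/-- The number of unbarred entries `u + 1` in `mu` on the diagonals from number `j` on. -/
def cnt (n u j : ℕ) : ℕ :=
  (Finset.univ.filter (fun c : Σ i : Fin d, Fin (mu i) =>
    L.barred (.inr c) = false ∧ (L.val (.inr c) : ℕ) = u ∧ j ≤ n - d + c.1 + u - c.2)).card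

/-- The values in `mu` are those encoded by the array `M`. -/
def ValMatches (n : ℕ) (M : ℕ → ℕ → ℕ) : Prop :=
  ∀ i j, InShape mu i j → ∀ u, i + u < d → (u ≤ L.entry i j ↔ i + 1 ≤ M u (n - d + i + u - j))

variable {L} {M : ℕ → ℕ → ℕ}

theorem _root_.PuzzleTableau.IsShape.mono (S : IsShape d n mu M) {u A B : ℕ} (hu : u ≤ d)
    (hAB : A ≤ B) (hB : B ≤ n) : M u A ≤ M u B ∧ M u B ≤ M u A + (B - A) := by
  induction B, hAB using Nat.le_induction with
  | base => simp
  | succ B hAB ih =>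
    have := ih (by omega)
    have := S.col u hu B (by omega)
    omega

/-- Iterating `diag` bounds `M u A` by the first row, which knows the shape `mu`. -/
theorem _root_.PuzzleTableau.IsShape.diag_iter (S : IsShape d n mu M) {u A : ℕ} (hu : u ≤ d)
    (hA : A ≤ n) (hpos : 1 ≤ M u A) : ∃ B, A = B + u ∧ M u A ≤ M 0 B := by
  induction u generalizing A with
  | zero => exact ⟨A, rfl, le_rfl⟩
  | succ u ih =>
    rcases A with _ | A
    · have := S.start (u + 1) hu
      omega
    · have h1 := S.diag u (by omega) A (by omega)
      obtain ⟨B, rfl, hB'⟩ := ih (by omega) (A := A) (by omega) (by omega)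
      exact ⟨B, by omega, by omega⟩

theorem _root_.PuzzleTableau.IsShape.inShape (S : IsShape d n mu M) {u A i : ℕ} (hu : u ≤ d)
    (hA : A ≤ n) (hi : i + 1 ≤ M u A) (hle : A ≤ n - d + i + u) :
    InShape mu i (n - d + i + u - A) := by
  have h1 := S.mono hu hA le_rfl
  rw [S.finish u hu] at h1
  obtain ⟨B, rfl, hB⟩ := S.diag_iter hu hA (by omega)
  have := (S.first ⟨i, by omega⟩ B (by omega)).1 (by simp only; omega)
  exact ⟨by omega, by simp only at this; omega⟩

/-- This recovers `M` from the entries. The alternative `n - d + i + u < A` is a virtual box beyond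
the right edge; it counts automatically, since `M u n = d - u` and `M u` grows by at most one per
step. -/
theorem _root_.PuzzleTableau.IsShape.le_iff (S : IsShape d n mu M) (hdn : d ≤ n)
    (V : L.ValMatches n M) {u A i : ℕ} (hu : u ≤ d) (hA : A ≤ n) :
    i + 1 ≤ M u A ↔ i + u < d ∧ (n - d + i + u < A ∨
      (InShape mu i (n - d + i + u - A) ∧ u ≤ L.entry i (n - d + i + u - A))) := by
  have h1 := S.mono hu hA le_rfl
  rw [S.finish u hu] at h1
  constructor
  · intro hi
    refine ⟨by omega, ?_⟩
    by_cases hlt : n - d + i + u < A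
    · exact Or.inl hlt
    · have hs := S.inShape hu hA hi (by omega)
      refine Or.inr ⟨hs, (V i _ hs u (by omega)).2 ?_⟩
      rwa [show n - d + i + u - (n - d + i + u - A) = A by omega]
  · rintro ⟨h2, h3 | ⟨h3, h4⟩⟩
    · omega
    · have := (V i _ h3 u h2).1 h4
      by_cases hlt : n - d + i + u < A
      · omega
      · rwa [show n - d + i + u - (n - d + i + u - A) = A by omega] at this

theorem exists_box (S : IsShape d n mu M) (hdn : d ≤ n) (hmu : mu ∈ boxPartitions d n)
    (V : L.ValMatches n M) {u A : ℕ} (hu : u < d) (hA : A < n)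
    (hD : M u A = M (u + 1) (A + 1) + 1) :
    ∃ c : Σ i : Fin d, Fin (mu i), (L.val (.inr c) : ℕ) = u ∧ n - d + c.1 + u - c.2 = A := by
  -- Rows below `M (u + 1) (A + 1)` on this diagonal have larger values, so the next row holds the
  -- value `u`.
  obtain ⟨i, hi⟩ : ∃ i, i = M (u + 1) (A + 1) := ⟨_, rfl⟩
  have h1 := S.mono hu.le hA.le le_rfl
  have h2 := S.mono (u := u + 1) hu (show A + 1 ≤ n from hA) le_rfl
  rw [S.finish u hu.le] at h1
  rw [S.finish (u + 1) hu] at h2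
  have hs := S.inShape hu.le hA.le (i := i) (by omega) (by omega)
  refine ⟨⟨⟨i, hs.1⟩, ⟨n - d + i + u - A, hs.2⟩⟩, ?_, by simp only; omega⟩
  have h3 := L.entry_eq ⟨⟨i, hs.1⟩, ⟨n - d + i + u - A, hs.2⟩⟩
  simp only at h3
  rw [← h3]
  have h4 := (V i _ hs u (by omega)).2
    (by rw [show n - d + i + u - (n - d + i + u - A) = A by omega]; omega)
  have h5 := L.entry_add_lt hmu.1 hs
  by_cases h6 : i + (u + 1) < d
  · have h7 := V i _ hs (u + 1) h6
    rw [show n - d + i + (u + 1) - (n - d + i + u - A) = A + 1 by omega] at h7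
    omega
  · omega

theorem diag_of_box (S : IsShape d n mu M) (hdn : d ≤ n) (hmu : mu ∈ boxPartitions d n)
    (V : L.ValMatches n M) {c : Σ i : Fin d, Fin (mu i)} {u A : ℕ} (hu : (L.val (.inr c) : ℕ) = u)
    (hA : n - d + c.1 + u - c.2 = A) :
    A < n ∧ (c.2 : ℕ) + A = n - d + c.1 + u ∧ M u A = M (u + 1) (A + 1) + 1 ∧ M u A = c.1 + 1 := by
  have hs := inShape c
  have h1 := L.entry_add_lt hmu.1 hs
  have h2 := hmu.2 c.1
  have h3 := c.2.2
  have h4 := L.entry_eq c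
  have hud : u < d := by omega
  have hAn : A < n := by omega
  have h5 := V _ _ hs u (by omega)
  rw [hA] at h5
  have h6 := S.row u hud (A + 1) hAn
  have h7 := S.col u hud.le A hAn
  have h8 := S.mono (u := u + 1) hud (show A + 1 ≤ n from hAn) le_rfl
  rw [S.finish (u + 1) hud] at h8
  refine ⟨hAn, by omega, ?_⟩
  by_cases h9 : (c.1 : ℕ) + (u + 1) < d
  · have h10 := V _ _ hs (u + 1) h9
    rw [show n - d + (c.1 : ℕ) + (u + 1) - c.2 = A + 1 by omega] at h10
    omega
  · omega

/-- The row of such a box is `M u A - 1`, so diagonal and value determine it. -/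
theorem box_unique (S : IsShape d n mu M) (hdn : d ≤ n) (hmu : mu ∈ boxPartitions d n)
    (V : L.ValMatches n M) {c c' : Σ i : Fin d, Fin (mu i)} {u : ℕ}
    (hu : (L.val (.inr c) : ℕ) = u) (hu' : (L.val (.inr c') : ℕ) = u)
    (hA : n - d + c.1 + u - c.2 = n - d + c'.1 + u - c'.2) : c = c' := by
  have h1 := diag_of_box S hdn hmu V hu rfl
  have h2 := diag_of_box S hdn hmu V hu' rfl
  rw [← hA] at h2
  have h3 : c.1 = c'.1 := Fin.ext (by omega)
  obtain ⟨i, j⟩ := c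
  obtain ⟨i', j'⟩ := c'
  simp only at h3
  subst h3
  have : j = j' := Fin.ext (by simp only at *; omega)
  rw [this]

theorem cnt_succ (S : IsShape d n mu M) (hdn : d ≤ n) (hmu : mu ∈ boxPartitions d n)
    (V : L.ValMatches n M) (u A : ℕ) :
    ((∃ c : Σ i : Fin d, Fin (mu i), L.barred (.inr c) = false ∧ (L.val (.inr c) : ℕ) = u ∧
      n - d + c.1 + u - c.2 = A) ∧ L.cnt n u A = L.cnt n u (A + 1) + 1) ∨
    ((¬ ∃ c : Σ i : Fin d, Fin (mu i), L.barred (.inr c) = false ∧ (L.val (.inr c) : ℕ) = u ∧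
      n - d + c.1 + u - c.2 = A) ∧ L.cnt n u A = L.cnt n u (A + 1)) := by
  classical
  by_cases h : ∃ c : Σ i : Fin d, Fin (mu i), L.barred (.inr c) = false ∧
      (L.val (.inr c) : ℕ) = u ∧ n - d + c.1 + u - c.2 = A
  · left
    refine ⟨h, ?_⟩
    obtain ⟨c, h1, h2, h3⟩ := h
    rw [cnt, cnt, ← Finset.card_insert_of_notMem (a := c)]
    · congr 1
      ext c'
      simp only [Finset.mem_filter, Finset.mem_univ, true_and, Finset.mem_insert]
      constructor
      · rintro ⟨h4, h5, h6⟩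
        by_cases h7 : n - d + c'.1 + u - c'.2 = A
        · exact Or.inl (box_unique S hdn hmu V h5 h2 (by omega))
        · exact Or.inr ⟨h4, h5, by omega⟩
      · rintro (rfl | ⟨h4, h5, h6⟩)
        · exact ⟨h1, h2, h3.ge⟩
        · exact ⟨h4, h5, by omega⟩
    · simp only [Finset.mem_filter, Finset.mem_univ, true_and]
      omega
  · right
    refine ⟨h, ?_⟩
    rw [cnt, cnt]
    congr 1
    ext c'
    simp only [Finset.mem_filter, Finset.mem_univ, true_and]
    refine and_congr_right fun h4 => and_congr_right fun h5 => ?_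
    have : n - d + (c'.1 : ℕ) + u - c'.2 ≠ A := fun h6 => h ⟨c', h4, h5, h6⟩
    omega

theorem cnt_top (S : IsShape d n mu M) (hdn : d ≤ n) (hmu : mu ∈ boxPartitions d n)
    (V : L.ValMatches n M) (u : ℕ) : L.cnt n u n = 0 := by
  rw [cnt, Finset.card_eq_zero, Finset.filter_eq_empty_iff]
  rintro c - ⟨-, h1, h2⟩
  have := diag_of_box S hdn hmu V h1 rfl
  omega

theorem cnt_anti (L : SkewBarredTableau lam mu) {n u j j' : ℕ} (h : j ≤ j') :
    L.cnt n u j' ≤ L.cnt n u j := by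
  refine Finset.card_le_card fun c => ?_
  simp only [Finset.mem_filter, Finset.mem_univ, true_and]
  rintro ⟨h1, h2, h3⟩
  exact ⟨h1, h2, by omega⟩

/-! ### Reading order and contents -/

/-- In the column reading, boxes with neighbouring values are ordered by their diagonals. -/
theorem readBefore_iff (hmu : Antitone mu) {b c : Σ i : Fin d, Fin (mu i)}
    (h1 : (L.val (.inr b) : ℕ) ≤ L.val (.inr c)) (h2 : (L.val (.inr c) : ℕ) ≤ L.val (.inr b) + 1) :
    Box.ReadBefore (lam := lam) (.inr b) (.inr c) ↔ (c.1 : ℕ) + b.2 < b.1 + c.2 := by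
  have hrb : Box.ReadBefore (lam := lam) (.inr b) (.inr c) ↔
      (b.2 : ℕ) < c.2 ∨ ((b.2 : ℕ) = c.2 ∧ (c.1 : ℕ) < b.1) := by
    simp only [Box.ReadBefore, Box.x, Box.y]
    omega
  rw [hrb]
  rw [← L.entry_eq b, ← L.entry_eq c] at h1 h2
  have hb := inShape b
  have hc := inShape c
  obtain ⟨⟨i', hi'⟩, ⟨j', hj'⟩⟩ := b
  obtain ⟨⟨i, hi⟩, ⟨j, hj⟩⟩ := c
  simp only at *
  constructor
  · rintro (h | ⟨h, h'⟩)
    · by_contra hlt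
      -- The corner box `(i', j)` compares the two entries along its row and its column: if `b` is
      -- not ahead of `c` diagonally, its entry exceeds that of `c`.
      have hs : InShape mu i' j := hc.mono hmu (by omega) le_rfl
      have h3 := L.entry_row hs h.le
      have h4 := L.entry_col_add hmu (i := i') (j := j) (i - i')
        (by rwa [show i' + (i - i') = i by omega])
      rw [show i' + (i - i') = i by omega] at h4
      omega
    · omega
  · intro h
    by_contra hlt
    -- With the corner `(i, j')` the entries differ by at least `i' - i`. As they differ by at most
    -- one, `b` is directly above `c`, hence read before it after all.
    have hs : InShape mu i j' := hb.mono hmu (by omega) le_rfl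
    have h3 := L.entry_row hs (show j ≤ j' by omega)
    have h4 := L.entry_col_add hmu (i := i) (j := j') (i' - i)
      (by rwa [show i + (i' - i) = i' by omega])
    rw [show i + (i' - i) = i' by omega] at h4
    omega

theorem readBefore_inl (b : Σ i : Fin d, Fin (lam i)) (c : Σ i : Fin d, Fin (mu i)) :
    Box.ReadBefore (lam := lam) (mu := mu) (.inl b) (.inr c) := by
  simp only [Box.ReadBefore, Box.x]
  omega

theorem content_eq (hl : ∀ c, L.val (.inl c) = c.1) (k : Fin d) :
    L.content k = lam k + L.cnt n k 0 := by
  rw [content, card_filter_box, cnt]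
  congr 1
  · rw [← card_row lam k]
    congr 1
    ext c
    simp [L.lam_unbarred, hl]
  · congr 1
    ext c
    simp [Fin.ext_iff]

theorem contentBefore_eq (hmu : mu ∈ boxPartitions d n) (hl : ∀ c, L.val (.inl c) = c.1)
    (c : Σ i : Fin d, Fin (mu i)) :
    L.contentBefore (.inr c) (L.val (.inr c)) = lam (L.val (.inr c)) +
      L.cnt n (L.val (.inr c)) (n - d + c.1 + L.val (.inr c) - c.2 + 1) := by
  rw [contentBefore, card_filter_box, cnt]
  congr 1
  · rw [← card_row lam]
    congr 1
    ext b
    simp [L.lam_unbarred, hl, readBefore_inl]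
  · congr 1
    ext b
    simp only [Finset.mem_filter, Finset.mem_univ, true_and, ← Fin.ext_iff]
    have h1 := hmu.2 c.1
    have h2 := c.2.2
    have h3 := hmu.2 b.1
    have h4 := b.2.2
    constructor
    · rintro ⟨h5, h6, h7⟩
      rw [readBefore_iff (L := L) hmu.1 (by rw [h7]) (by rw [h7]; omega)] at h5
      exact ⟨h6, h7, by omega⟩
    · rintro ⟨h6, h7, h5⟩
      refine ⟨?_, h6, h7⟩
      rw [readBefore_iff (L := L) hmu.1 (by rw [h7]) (by rw [h7]; omega)]
      omega

/-- Lowering the value by one shifts the diagonal number by one, so the bound is the diagonal of `c`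
itself, without the `+ 1` of `contentBefore_eq`. -/
theorem contentUpTo_eq (hmu : mu ∈ boxPartitions d n) (hl : ∀ c, L.val (.inl c) = c.1)
    (c : Σ i : Fin d, Fin (mu i)) {k : Fin d} (hk : (L.val (.inr c) : ℕ) = k + 1) :
    L.contentUpTo (.inr c) k = lam k +
      L.cnt n k (n - d + c.1 + L.val (.inr c) - c.2) := by
  rw [contentUpTo, card_filter_box, cnt]
  congr 1
  · rw [← card_row lam]
    congr 1
    ext b
    simp [L.lam_unbarred, hl, readBefore_inl]
  · congr 1
    ext b
    simp only [Finset.mem_filter, Finset.mem_univ, true_and]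
    have h1 := hmu.2 c.1
    have h2 := c.2.2
    have h3 := hmu.2 b.1
    have h4 := b.2.2
    have hne : (L.val (.inr b) : ℕ) = k → (Sum.inr b : Box lam mu) ≠ .inr c := by
      rintro h5 h6
      rw [h6] at h5
      omega
    constructor
    · rintro ⟨h5, h6, h7⟩
      have h7 : (L.val (.inr b) : ℕ) = k := congrArg _ h7
      rw [or_iff_left (hne h7), readBefore_iff (L := L) hmu.1 (by omega) (by omega)] at h5
      exact ⟨h6, h7, by omega⟩
    · rintro ⟨h6, h7, h5⟩
      refine ⟨?_, h6, Fin.ext h7⟩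
      rw [or_iff_left (hne h7), readBefore_iff (L := L) hmu.1 (by omega) (by omega)]
      omega

theorem contentUpTo_self (hmu : mu ∈ boxPartitions d n) (hl : ∀ c, L.val (.inl c) = c.1)
    (c : Σ i : Fin d, Fin (mu i)) (hc : L.barred (.inr c) = false) :
    lam (L.val (.inr c)) + L.cnt n (L.val (.inr c)) (n - d + c.1 + L.val (.inr c) - c.2 + 1) + 1 ≤
      L.contentUpTo (.inr c) (L.val (.inr c)) := by
  classical
  rw [← contentBefore_eq hmu hl, contentBefore, contentUpTo,
    ← Finset.card_insert_of_notMem (a := (Sum.inr c : Box lam mu))]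
  · refine Finset.card_le_card fun b => ?_
    simp only [Finset.mem_filter, Finset.mem_univ, true_and, Finset.mem_insert]
    rintro (rfl | ⟨h1, h2⟩)
    · exact ⟨Or.inr rfl, hc, rfl⟩
    · exact ⟨Or.inl h1, h2⟩
  · rw [Finset.mem_filter]
    rintro ⟨-, h, -⟩
    simp [Box.ReadBefore] at h

/-- The entries in `lam` are determined by the Yamanouchi condition. -/
theorem val_lam (hlam : Antitone lam) (hY : L.IsYamanouchi) (c : Σ i : Fin d, Fin (lam i)) :
    L.val (.inl c) = c.1 := by
  obtain ⟨N, hN⟩ : ∃ N, ∀ i, lam i ≤ N := ⟨∑ i, lam i, fun i => by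
    exact Finset.single_le_sum (fun _ _ => Nat.zero_le _) (Finset.mem_univ i)⟩
  -- Induction along the reading order: columns from the right, with `k = N - c.2`, then rows from
  -- the top.
  have key : ∀ k i : ℕ, ∀ c : Σ i : Fin d, Fin (lam i), (c.2 : ℕ) + k = N → (c.1 : ℕ) = i →
      L.val (.inl c) = c.1 := by
    intro k
    induction k using Nat.strong_induction_on with
    | _ k ihk =>
    intro i
    induction i using Nat.strong_induction_on with
    | _ i ihi =>
    intro c hck hci
    have hprev : ∀ b : Σ i : Fin d, Fin (lam i), Box.ReadBefore (mu := mu) (.inl b) (.inl c) →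
        L.val (.inl b) = b.1 ∧ ((c.2 : ℕ) < b.2 ∨ (b.1 : ℕ) < c.1) := by
      intro b hb
      have hb' : (c.2 : ℕ) < b.2 ∨ ((b.2 : ℕ) = c.2 ∧ (b.1 : ℕ) < c.1) := by
        have h1 := b.1.2
        have h2 := c.1.2
        simp only [Box.ReadBefore, Box.x, Box.y] at hb
        omega
      have h3 := hN b.1
      have h4 := b.2.2
      rcases hb' with h | ⟨h, h'⟩
      · exact ⟨ihk (N - b.2) (by omega) b.1 b (by omega) rfl, Or.inl h⟩
      · exact ⟨ihi b.1 (by omega) b (by omega) rfl, Or.inr h'⟩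
    obtain ⟨⟨i', hi'⟩, ⟨j, hj⟩⟩ := c
    simp only at hci hck
    subst hci
    have hge : i' ≤ (L.val (.inl ⟨⟨i', hi'⟩, ⟨j, hj⟩⟩) : ℕ) := by
      rcases i' with _ | i'
      · exact Nat.zero_le _
      · have h1 : lam ⟨i' + 1, hi'⟩ ≤ lam ⟨i', by omega⟩ := hlam (by simp)
        have h2 := ihi i' (by omega) ⟨⟨i', by omega⟩, ⟨j, by omega⟩⟩ hck rfl
        have h3 := L.col_strict (.inl ⟨⟨i', by omega⟩, ⟨j, by omega⟩⟩)
          (.inl ⟨⟨i' + 1, hi'⟩, ⟨j, hj⟩⟩) (by simp [Box.x]) (by simp [Box.y])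
        rw [h2] at h3
        exact h3
    have hle : (L.val (.inl ⟨⟨i', hi'⟩, ⟨j, hj⟩⟩) : ℕ) ≤ i' := by
      by_contra hlt
      have hlast : lam ⟨i', hi'⟩ = j + 1 := by
        by_contra hne
        have h2 := (hprev ⟨⟨i', hi'⟩, ⟨j + 1, by omega⟩⟩
          (by simp [Box.ReadBefore, Box.x])).1
        have h3 := L.row_weak (.inl ⟨⟨i', hi'⟩, ⟨j, hj⟩⟩) (.inl ⟨⟨i', hi'⟩, ⟨j + 1, by omega⟩⟩)
          (by simp [Box.y]) (by simp [Box.x])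
        rw [h2] at h3
        exact hlt h3
      obtain ⟨u, hu⟩ : ∃ u, u = L.val (.inl ⟨⟨i', hi'⟩, ⟨j, hj⟩⟩) := ⟨_, rfl⟩
      have h1 : 1 ≤ L.contentUpTo (.inl ⟨⟨i', hi'⟩, ⟨j, hj⟩⟩) u := by
        rw [contentUpTo, Nat.succ_le_iff, Finset.card_pos]
        exact ⟨.inl ⟨⟨i', hi'⟩, ⟨j, hj⟩⟩, by simp [L.lam_unbarred, hu]⟩
      have h2 := hY (.inl ⟨⟨i', hi'⟩, ⟨j, hj⟩⟩) ⟨u - 1, by omega⟩ u (by simp only; omega)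
      have h3 := h1.trans h2
      rw [contentUpTo, Nat.succ_le_iff, Finset.card_pos] at h3
      obtain ⟨b, hb⟩ := h3
      simp only [Finset.mem_filter, Finset.mem_univ, true_and] at hb
      obtain ⟨hb1 | hb1, -, hb2⟩ := hb
      · rcases b with b | b
        · obtain ⟨h4, h5⟩ := hprev b hb1
          rw [h4] at hb2
          have h6 : (b.1 : ℕ) = u - 1 := by rw [hb2]
          have h7 : lam b.1 ≤ lam ⟨i', hi'⟩ := hlam (by rw [Fin.le_def]; simp only; omega)
          have h8 := b.2.2
          simp only at h5
          omega
        · simp only [Box.ReadBefore, Box.x] at hb1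
          omega
      · rw [hb1, ← hu] at hb2
        have h6 : (u : ℕ) = u - 1 := congrArg Fin.val hb2
        omega
    exact Fin.ext (le_antisymm hle hge)
  exact key (N - c.2) c.1 c (by have := hN c.1; have := c.2.2; omega) rfl

end SkewBarredTableau


/-! ### From tableaux to pairs of arrays -/

namespace SkewBarredTableau

variable {d n : ℕ} {lam mu nu : Fin d → ℕ} {L L' : SkewBarredTableau lam mu} {M p : ℕ → ℕ → ℕ}

/-- The tableau is encoded by the pair of arrays `M` and `p`. -/
structure Matches (n : ℕ) (L : SkewBarredTableau lam mu) (M p : ℕ → ℕ → ℕ) : Prop where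
  lam_val : ∀ c, L.val (.inl c) = c.1
  vals : L.ValMatches n M
  bars : ∀ c : Σ i : Fin d, Fin (mu i), L.barred (.inr c) = true ↔
    p (L.val (.inr c)) (n - d + c.1 + L.val (.inr c) - c.2) =
      p (L.val (.inr c)) (n - d + c.1 + L.val (.inr c) - c.2 + 1)

/-- The array that encodes the values of a tableau. -/
theorem exists_isShape (hdn : d ≤ n) (hmu : mu ∈ boxPartitions d n)
    (L : SkewBarredTableau lam mu) : ∃ M, IsShape d n mu M ∧ L.ValMatches n M := by
  classical
  -- Row `i` of the diagonal number `A` for the value `u` holds a virtual box or an entry `≥ u`.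
  let Q : ℕ → ℕ → ℕ → Prop := fun u A i => n - d + i + u < A ∨
    (InShape mu i (n - d + i + u - A) ∧ u ≤ L.entry i (n - d + i + u - A))
  let M : ℕ → ℕ → ℕ := fun u A => ((Finset.range (d - u)).filter (Q u A)).card
  have hb : ∀ {i j}, InShape mu i j → j < n - d := fun h => h.2.trans_le (hmu.2 _)
  have hQ0 : ∀ u A i, n - d + i + u < A → Q u A i := fun u A i h => Or.inl h
  have hQ1 : ∀ u A i j, n - d + i + u = A + j → InShape mu i j → u ≤ L.entry i j → Q u A i := by
    intro u A i j h h1 h2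
    refine Or.inr ?_
    rw [show n - d + i + u - A = j by omega]
    exact ⟨h1, h2⟩
  have hQ : ∀ u A i, Q u A i → n - d + i + u < A ∨
      ∃ j, n - d + i + u = A + j ∧ InShape mu i j ∧ u ≤ L.entry i j := by
    rintro u A i (h | ⟨h1, h2⟩)
    · exact Or.inl h
    · by_cases h : n - d + i + u < A
      · exact Or.inl h
      · exact Or.inr ⟨_, by omega, h1, h2⟩
  -- Going down a diagonal towards the corner, entries strictly increase, so the rows counted form
  -- an initial segment.
  have hdown : ∀ u A i, Q u A (i + 1) → Q u A i := by
    intro u A i h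
    rcases hQ _ _ _ h with h | ⟨j, h1, h2, h3⟩
    · exact hQ0 _ _ _ (by omega)
    · rcases j with _ | j
      · exact hQ0 _ _ _ (by omega)
      · have h4 := L.entry_col hmu.1 h2
        have h5 := L.entry_row (h2.mono hmu.1 (Nat.le_succ i) le_rfl) (Nat.le_succ j)
        exact hQ1 _ _ _ j (by omega) (h2.mono hmu.1 (by omega) (by omega)) (by omega)
  have hM : ∀ u A i, i + 1 ≤ M u A ↔ i < d - u ∧ Q u A i := fun u A i =>
    succ_le_card_filter_range (fun i _ => hdown u A i) i
  refine ⟨M, ⟨?_, ?_, ?_, ?_, ?_, ?_, ?_⟩, ?_⟩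
  · intro j _
    simp [M]
  · intro u hu
    refine Nat.le_zero.1 (le_of_forall_succ_le fun i hi => ?_)
    rcases hQ _ _ _ ((hM u 0 i).1 hi).2 with h | ⟨j, h1, h2, h3⟩
    · omega
    · have := hb h2
      omega
  · intro u hu
    refine le_antisymm (le_of_forall_succ_le fun i hi => ((hM _ _ _).1 hi).1)
      (le_of_forall_succ_le fun i hi => (hM _ _ _).2 ⟨hi, hQ0 _ _ _ (by omega)⟩)
  · intro u hu j hj
    refine ⟨le_of_forall_succ_le fun i hi => ?_, le_succ_of_forall fun i hi => ?_⟩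
    · obtain ⟨h0, h⟩ := (hM _ _ _).1 hi
      refine (hM _ _ _).2 ⟨by omega, ?_⟩
      rcases hQ _ _ _ h with h | ⟨k, h1, h2, h3⟩
      · exact hQ0 _ _ _ (by omega)
      · rcases k with _ | k
        · exact hQ0 _ _ _ (by omega)
        · have := L.entry_row h2 (Nat.le_succ k)
          exact hQ1 _ _ _ k (by omega) (h2.mono hmu.1 le_rfl (by omega)) (by omega)
    · obtain ⟨h0, h⟩ := (hM _ _ (i + 1)).1 hi
      refine (hM _ _ _).2 ⟨by omega, ?_⟩
      rcases hQ _ _ _ h with h | ⟨k, h1, h2, h3⟩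
      · exact hQ0 _ _ _ (by omega)
      · have := L.entry_col hmu.1 h2
        exact hQ1 _ _ _ k (by omega) (h2.mono hmu.1 (by omega) le_rfl) (by omega)
  · intro u hu A hA
    refine ⟨le_of_forall_succ_le fun i hi => ?_, le_succ_of_forall fun i hi => ?_⟩
    · obtain ⟨h0, h⟩ := (hM _ _ _).1 hi
      refine (hM _ _ _).2 ⟨by omega, ?_⟩
      rcases hQ _ _ _ h with h | ⟨k, h1, h2, h3⟩
      · exact hQ0 _ _ _ (by omega)
      · rcases k with _ | k
        · exact hQ0 _ _ _ (by omega)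
        · have := L.entry_row h2 (Nat.le_succ k)
          exact hQ1 _ _ _ k (by omega) (h2.mono hmu.1 le_rfl (by omega)) (by omega)
    · obtain ⟨h0, h⟩ := (hM _ _ (i + 1)).1 hi
      refine (hM _ _ _).2 ⟨by omega, ?_⟩
      rcases hQ _ _ _ h with h | ⟨k, h1, h2, h3⟩
      · exact hQ0 _ _ _ (by omega)
      · have := L.entry_col hmu.1 h2
        exact hQ1 _ _ _ k (by omega) (h2.mono hmu.1 (by omega) le_rfl) (by omega)
  · intro u hu A hA
    refine le_of_forall_succ_le fun i hi => ?_
    obtain ⟨h0, h⟩ := (hM _ _ _).1 hi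
    refine (hM _ _ _).2 ⟨by omega, ?_⟩
    rcases hQ _ _ _ h with h | ⟨k, h1, h2, h3⟩
    · exact hQ0 _ _ _ (by omega)
    · exact hQ1 _ _ _ k (by omega) h2 (by omega)
  · intro i A hA
    rw [hM]
    have hi := i.2
    constructor
    · rintro ⟨-, h⟩
      rcases hQ _ _ _ h with h | ⟨k, h1, h2, h3⟩
      · omega
      · have := h2.2
        simp only [Fin.eta] at this
        omega
    · intro h
      refine ⟨by omega, ?_⟩
      by_cases h1 : n - d + (i : ℕ) < A
      · exact hQ0 _ _ _ (by omega)
      · exact hQ1 _ _ _ (n - d + i - A) (by omega) ⟨hi, by simp only [Fin.eta]; omega⟩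
          (Nat.zero_le _)
  · intro i j hs u hu
    have := hb hs
    rw [hM]
    constructor
    · intro h
      exact ⟨by omega, hQ1 _ _ _ j (by omega) hs h⟩
    · rintro ⟨-, h⟩
      rcases hQ _ _ _ h with h | ⟨k, h1, h2, h3⟩
      · omega
      · rwa [show j = k by omega]

/-- The positivity condition for all nonzero labels follows from the one for barred entries. -/
theorem pos_of_barred (S : IsShape d n mu M) (hn : ∀ u < d, p u n < n)
    (step : ∀ u < d, ∀ A < n,
      p u A = p u (A + 1) ∨ (p u A + 1 = p u (A + 1) ∧ M u A = M (u + 1) (A + 1) + 1))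
    (lt_succ : ∀ u, u + 1 < d → ∀ j ≤ n, p u j < p (u + 1) j)
    (hpos : ∀ u < d, ∀ A < n, M u A = M (u + 1) (A + 1) + 1 → p u A = p u (A + 1) → p u A < A)
    (u : ℕ) (hu : u < d) (j : ℕ) (hj : j ≤ n) (hM : M u j = M (u + 1) j + 1) : p u j < j := by
  have key : ∀ k ≤ n, ∀ u < d, M u (n - k) = M (u + 1) (n - k) + 1 → p u (n - k) < n - k := by
    intro k
    induction k with
    | zero => exact fun _ u hu _ => hn u hu
    | succ k ih =>
      intro hk u hu hM
      obtain ⟨A, hA⟩ : ∃ A, A = n - (k + 1) := ⟨_, rfl⟩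
      rw [show n - k = A + 1 by omega] at ih
      rw [← hA] at hM ⊢
      have hAn : A < n := by omega
      have h1 := S.diag u hu A hAn
      have h2 := S.row u hu (A + 1) hAn
      have h3 := S.col u hu.le A hAn
      have h4 := S.col (u + 1) hu A hAn
      -- In this case token `u` is a `one` on line `A + 1` as well. Either it moves left, which
      -- keeps it inside, or it marks a barred box.
      by_cases hD : M u A = M (u + 1) (A + 1) + 1
      · have h5 := ih (by omega) u hu (by omega)
        rcases step u hu A hAn with h6 | ⟨h6, -⟩
        · exact hpos u hu A hAn hD h6
        · omega
      -- Otherwise token `u + 1` is a `one` on line `A + 1`, hence inside by induction, and token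
      -- `u` lies strictly to its left on line `A`.
      · have hlt : u + 1 < d := by
          by_contra hc
          have hud : u + 1 = d := by omega
          have e1 := S.last (A + 1) hAn
          have e2 := S.last A hAn.le
          rw [← hud] at e1 e2
          omega
        have h5 := S.diag (u + 1) hlt A hAn
        have h6 := S.row (u + 1) hlt (A + 1) hAn
        have h7 := S.row (u + 1) hlt A hAn.le
        have h8 := S.col (u + 1 + 1) hlt A hAn
        have h9 := lt_succ u hlt A hAn.le
        have h10 := ih (by omega) (u + 1) hlt
        have h11 := step (u + 1) hlt A hAn
        by_cases h12 : M (u + 1) (A + 1) = M (u + 1 + 1) (A + 1) + 1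
        · have := h10 h12
          omega
        · omega
  have := key (n - j) (by omega) u hu
  rw [Nat.sub_sub_self hj] at this
  exact this hM

/-- Every positive tableau is encoded by a pair of arrays. -/
theorem exists_isArray (hdn : d ≤ n) (hlam : lam ∈ boxPartitions d n)
    (hmu : mu ∈ boxPartitions d n) (hnu : nu ∈ boxPartitions d n)
    (hL : L ∈ positiveTableaux lam mu nu) :
    ∃ M p, IsArray d n lam mu nu M p ∧ L.Matches n M p := by
  obtain ⟨hY, hC, hP⟩ := hL
  have hl := val_lam hlam.1 hY
  obtain ⟨M, S, V⟩ := exists_isShape hdn hmu L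
  have hcnt : ∀ u j, ∀ hu : u < d, lam ⟨u, hu⟩ + L.cnt n u j ≤ nu ⟨u, hu⟩ := by
    intro u j hu
    have h1 := content_eq (n := n) hl ⟨u, hu⟩
    rw [hC] at h1
    have := cnt_anti L (n := n) (u := u) (Nat.zero_le j)
    simp only at h1
    omega
  -- On passing to line `A` the left side grows only at an unbarred box of value `u + 1`; there the
  -- Yamanouchi property gives the inequality.
  have hY' : ∀ k ≤ n, ∀ u, ∀ hu : u + 1 < d, lam ⟨u + 1, hu⟩ + L.cnt n (u + 1) (n - k) ≤
      lam ⟨u, by omega⟩ + L.cnt n u (n - k) := by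
    intro k
    induction k with
    | zero =>
      intro _ u hu
      rw [Nat.sub_zero, cnt_top S hdn hmu V, cnt_top S hdn hmu V]
      exact hlam.1 (by simp)
    | succ k ih =>
      intro hk u hu
      have h0 := ih (by omega) u hu
      obtain ⟨A, hA⟩ : ∃ A, A = n - (k + 1) := ⟨_, rfl⟩
      rw [show n - k = A + 1 by omega] at h0
      rw [← hA]
      have h1 := cnt_anti L (n := n) (u := u) (Nat.le_succ A)
      rcases cnt_succ S hdn hmu V (u + 1) A with ⟨⟨c, h2, h3, h4⟩, h5⟩ | ⟨-, h5⟩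
      · have h6 := contentUpTo_self hmu hl c h2
        have h7 := hY (.inr c) ⟨u, by omega⟩ (L.val (.inr c)) h3
        rw [contentUpTo_eq hmu hl c (k := ⟨u, by omega⟩) h3] at h7
        have h8 : L.val (.inr c) = ⟨u + 1, hu⟩ := Fin.ext h3
        rw [h8] at h6 h7
        simp only [h4] at h6 h7
        simp only [Nat.succ_eq_add_one] at h1
        omega
      · simp only [Nat.succ_eq_add_one] at h1
        omega
  -- A token starts from its `lam` position and makes one step left for every unbarred entry of its
  -- value; the total displacement is `nu`.
  let p : ℕ → ℕ → ℕ := fun u j =>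
    n - d + u - ((if h : u < d then lam ⟨u, h⟩ else 0) + L.cnt n u j)
  have hp : ∀ u j, ∀ hu : u < d, p u j + (lam ⟨u, hu⟩ + L.cnt n u j) = n - d + u := by
    intro u j hu
    have h1 := hcnt u j hu
    have h2 := hnu.2 ⟨u, hu⟩
    simp only [p, hu, ↓reduceDIte]
    omega
  have hstep : ∀ u < d, ∀ A < n,
      p u A = p u (A + 1) ∨ (p u A + 1 = p u (A + 1) ∧ M u A = M (u + 1) (A + 1) + 1) := by
    intro u hu A hA
    have h1 := hp u A hu
    have h2 := hp u (A + 1) hu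
    rcases cnt_succ S hdn hmu V u A with ⟨⟨c, h3, h4, h5⟩, h6⟩ | ⟨-, h6⟩
    · exact Or.inr ⟨by omega, (diag_of_box S hdn hmu V h4 h5).2.2.1⟩
    · exact Or.inl (by omega)
  have hlt : ∀ u, u + 1 < d → ∀ j ≤ n, p u j < p (u + 1) j := by
    intro u hu j hj
    have h1 := hY' (n - j) (by omega) u hu
    rw [Nat.sub_sub_self hj] at h1
    have h2 := hp u j (by omega)
    have h3 := hp (u + 1) j hu
    omega
  have hbars : ∀ c : Σ i : Fin d, Fin (mu i), L.barred (.inr c) = true ↔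
      p (L.val (.inr c)) (n - d + c.1 + L.val (.inr c) - c.2) =
        p (L.val (.inr c)) (n - d + c.1 + L.val (.inr c) - c.2 + 1) := by
    intro c
    have h1 := hp (L.val (.inr c)) (n - d + c.1 + L.val (.inr c) - c.2) (L.val (.inr c)).2
    have h2 := hp (L.val (.inr c)) (n - d + c.1 + L.val (.inr c) - c.2 + 1) (L.val (.inr c)).2
    rcases cnt_succ S hdn hmu V (L.val (.inr c)) (n - d + c.1 + L.val (.inr c) - c.2)
      with ⟨⟨c', h3, h4, h5⟩, h6⟩ | ⟨h5, h6⟩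
    · rw [box_unique S hdn hmu V h4 rfl h5] at h3
      rw [h3]
      simp only [Bool.false_eq_true, false_iff]
      omega
    · refine iff_of_true ?_ (by omega)
      by_contra hc
      exact h5 ⟨c, by simpa using hc, rfl, rfl⟩
  refine ⟨M, p, ⟨S, hstep, hlt, ?_, ?_, ?_⟩, hl, V, hbars⟩
  · intro i
    have := hp i n i.2
    rw [cnt_top S hdn hmu V] at this
    simpa using this
  · intro i
    have h1 := content_eq (n := n) hl i
    have h2 := hp i 0 i.2
    rw [hC] at h1
    simp only [Fin.eta] at h2
    omega
  · refine pos_of_barred S ?_ hstep hlt ?_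
    · intro u hu
      have := hp u n hu
      omega
    · intro u hu A hA hD he
      obtain ⟨c, h1, h2⟩ := exists_box S hdn hmu V hu hA hD
      subst h1 h2
      have h3 := (hbars c).2 he
      have h4 := hP (L.cFactor c) (Multiset.mem_map_of_mem _ (by
        rw [Finset.mem_val, barredBoxes, Finset.mem_filter]
        exact ⟨Finset.mem_univ _, h3⟩))
      have h5 := hp (L.val (.inr c)) (n - d + c.1 + L.val (.inr c) - c.2 + 1) (L.val (.inr c)).2
      have h6 := (diag_of_box S hdn hmu V rfl rfl : _ ∧ _ ∧ _ ∧ M (L.val (.inr c)) _ = c.1 + 1).2.1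
      simp only [cFactor, omega, colNum, rowNum, contentBefore_eq hmu hl] at h4
      simp only [Fin.eta] at h5
      omega

/-- By `bars` and `step`, the moves of token `u` correspond to the unbarred entries of value `u`,
diagonal by diagonal. -/
theorem Matches.add_cnt (hdn : d ≤ n) (hmu : mu ∈ boxPartitions d n)
    (h : IsArray d n lam mu nu M p) (m : L.Matches n M p) {u j : ℕ} (hu : u < d) (hj : j ≤ n) :
    p u j + L.cnt n u j = p u n := by
  have S := h.toIsShape
  have key : ∀ k ≤ n, p u (n - k) + L.cnt n u (n - k) = p u n := by
    intro k
    induction k with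
    | zero => simp [cnt_top S hdn hmu m.vals]
    | succ k ih =>
      intro hk
      have h0 := ih (by omega)
      obtain ⟨A, hA⟩ : ∃ A, A = n - (k + 1) := ⟨_, rfl⟩
      rw [show n - k = A + 1 by omega] at h0
      rw [← hA]
      rcases cnt_succ S hdn hmu m.vals u A with ⟨⟨c, h2, h3, h4⟩, h5⟩ | ⟨h4, h5⟩
      · subst h3 h4
        have h6 := m.bars c
        rw [h2] at h6
        simp only [Bool.false_eq_true, false_iff] at h6
        have h7 := h.step _ hu _ (show n - d + c.1 + L.val (.inr c) - c.2 < n by omega)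
        omega
      · rcases h.step u hu A (by omega) with h6 | ⟨h6, h7⟩
        · omega
        · obtain ⟨c, h8, h9⟩ := exists_box S hdn hmu m.vals hu (by omega) h7
          exfalso
          refine h4 ⟨c, ?_, h8, h9⟩
          subst h8 h9
          have := m.bars c
          rw [← Bool.not_eq_true, this]
          omega
  have := key (n - j) (by omega)
  rwa [Nat.sub_sub_self hj] at this

/-- The arrays are determined by the tableau. -/
theorem Matches.arrays_unique (hdn : d ≤ n) (hmu : mu ∈ boxPartitions d n) {M' p' : ℕ → ℕ → ℕ}
    (h : IsArray d n lam mu nu M p) (h' : IsArray d n lam mu nu M' p')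
    (m : L.Matches n M p) (m' : L.Matches n M' p') :
    ∀ j ≤ n, (∀ u ≤ d, M u j = M' u j) ∧ ∀ u < d, p u j = p' u j := by
  intro j hj
  constructor
  · intro u hu
    refine le_antisymm (le_of_forall_succ_le fun i hi => ?_) (le_of_forall_succ_le fun i hi => ?_)
    · rw [h'.toIsShape.le_iff hdn m'.vals hu hj]
      rwa [h.toIsShape.le_iff hdn m.vals hu hj] at hi
    · rw [h.toIsShape.le_iff hdn m.vals hu hj]
      rwa [h'.toIsShape.le_iff hdn m'.vals hu hj] at hi
  · intro u hu
    have h1 := m.add_cnt hdn hmu h hu hj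
    have h2 := m'.add_cnt hdn hmu h' hu hj
    have h3 := h.top ⟨u, hu⟩
    have h4 := h'.top ⟨u, hu⟩
    simp only at h3 h4
    omega

/-- The tableau is determined by the arrays. -/
theorem Matches.eq (hmu : mu ∈ boxPartitions d n) {M' p' : ℕ → ℕ → ℕ}
    (m : L.Matches n M p) (m' : L'.Matches n M' p')
    (he : ∀ j ≤ n, (∀ u ≤ d, M u j = M' u j) ∧ ∀ u < d, p u j = p' u j) (hdn : d ≤ n) :
    L = L' := by
  have key : ∀ {L L' : SkewBarredTableau lam mu} {M M' : ℕ → ℕ → ℕ}, L.ValMatches n M →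
      L'.ValMatches n M' → (∀ j ≤ n, ∀ u ≤ d, M u j = M' u j) → ∀ c : Σ i : Fin d, Fin (mu i),
      L.entry c.1 c.2 ≤ L'.entry c.1 c.2 := by
    intro L L' M M' V V' he c
    have hs := inShape c
    have h1 := L.entry_add_lt hmu.1 hs
    -- Both encodings are evaluated at `u = L.entry c.1 c.2`.
    rw [V' _ _ hs _ h1, ← he _ (by omega) _ (by omega), ← V _ _ hs _ h1]
  have hval : ∀ c : Σ i : Fin d, Fin (mu i), L.val (.inr c) = L'.val (.inr c) := by
    intro c
    have h1 := key m.vals m'.vals (fun j hj => (he j hj).1) c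
    have h2 := key m'.vals m.vals (fun j hj u hu => ((he j hj).1 u hu).symm) c
    rw [entry_eq, entry_eq] at h1 h2
    exact Fin.ext (le_antisymm h1 h2)
  ext b
  · rcases b with c | c
    · rw [m.lam_val, m'.lam_val]
    · rw [hval]
  · rcases b with c | c
    · rw [L.lam_unbarred, L'.lam_unbarred]
    · have hs := inShape c
      have h1 := L.entry_add_lt hmu.1 hs
      rw [entry_eq] at h1
      have h2 := c.2.2
      have h3 := hmu.2 c.1
      rw [Bool.eq_iff_iff, m.bars, m'.bars, ← hval,
        (he _ (by omega)).2 _ (L.val (.inr c)).2, (he _ (by omega)).2 _ (L.val (.inr c)).2]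

end SkewBarredTableau


/-! ### From pairs of arrays to tableaux, up to irrelevant values of the arrays -/

theorem wLab_congr {d n : ℕ} {M p M' p' : ℕ → ℕ → ℕ}
    (he : ∀ j ≤ n, (∀ u ≤ d, M u j = M' u j) ∧ ∀ u < d, p u j = p' u j) {j a : ℕ} (hj : j ≤ n) :
    wLab d M p j a = wLab d M' p' j a := by
  have h1 : (∃ u < d, p u j = a ∧ M u j = M (u + 1) j + 1) ↔
      ∃ u < d, p' u j = a ∧ M' u j = M' (u + 1) j + 1 :=
    exists_congr fun u => and_congr_right fun hu => by
      rw [(he j hj).2 u hu, (he j hj).1 u hu.le, (he j hj).1 (u + 1) hu]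
  have h2 : (∃ u < d, p u j = a) ↔ ∃ u < d, p' u j = a :=
    exists_congr fun u => and_congr_right fun hu => by rw [(he j hj).2 u hu]
  simp only [wLab, h1, h2]

theorem xLab_congr {d n : ℕ} {M p M' p' : ℕ → ℕ → ℕ}
    (he : ∀ j ≤ n, (∀ u ≤ d, M u j = M' u j) ∧ ∀ u < d, p u j = p' u j) {A a : ℕ} (hA : A < n) :
    xLab d M p A a = xLab d M' p' A a := by
  have h1 : (∃ u < d, p u (A + 1) = a ∧ p u A + 1 = a) ↔
      ∃ u < d, p' u (A + 1) = a ∧ p' u A + 1 = a :=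
    exists_congr fun u => and_congr_right fun hu => by
      rw [(he A hA.le).2 u hu, (he (A + 1) hA).2 u hu]
  have h2 : numBefore d p (A + 1) a = numBefore d p' (A + 1) a := by
    rw [numBefore, numBefore]
    congr 1
    refine Finset.filter_congr fun u hu => ?_
    rw [(he (A + 1) hA).2 u (Finset.mem_range.1 hu)]
  have h3 := (he A hA.le).1 _ (numBefore_le (d := d) (p := p') (j := A + 1) (a := a))
  have h4 := (he (A + 1) hA).1 _ (numBefore_le (d := d) (p := p') (j := A + 1) (a := a))
  simp only [xLab, h1, h2, h3, h4]

theorem arrayLab_congr {d n : ℕ} {M p M' p' : ℕ → ℕ → ℕ}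
    (he : ∀ j ≤ n, (∀ u ≤ d, M u j = M' u j) ∧ ∀ u < d, p u j = p' u j) {t : UnitTriangle}
    (ht : t.Inside n) {e : Edge} (het : e ∈ t.edges) : arrayLab d M p e = arrayLab d M' p' e := by
  cases t <;> simp only [UnitTriangle.edges, List.mem_cons, List.not_mem_nil, or_false] at het <;>
    simp only [UnitTriangle.Inside] at ht <;> rcases het with rfl | rfl | rfl <;>
    simp only [arrayLab]
  · exact xLab_congr he (by omega)
  · exact wLab_congr he (by omega)
  · rw [xLab_congr he (by omega), wLab_congr he (by omega)]
  · exact wLab_congr he (by omega)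
  · rw [xLab_congr he (by omega), wLab_congr he (by omega)]
  · exact xLab_congr he (by omega)

namespace SkewBarredTableau

variable {d n : ℕ} {lam mu nu : Fin d → ℕ} {M p : ℕ → ℕ → ℕ}

theorem contentUpTo_mono {L : SkewBarredTableau lam mu} {a b : Box lam mu} (k : Fin d)
    (h : Box.ReadBefore b a ∨ b = a) : L.contentUpTo b k ≤ L.contentUpTo a k := by
  refine Finset.card_le_card fun e => ?_
  simp only [Finset.mem_filter, Finset.mem_univ, true_and]
  rintro ⟨h1, h2⟩
  refine ⟨?_, h2⟩
  rcases h with h | rfl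
  · rcases h1 with h1 | rfl
    · left
      simp only [Box.ReadBefore] at *
      omega
    · exact Or.inl h
  · exact h1

/-- The boxes of `mu` that are read up to a given box. -/
theorem contentUpTo_inr {L : SkewBarredTableau lam mu} (hl : ∀ c, L.val (.inl c) = c.1)
    (c : Σ i : Fin d, Fin (mu i)) (k : Fin d) :
    L.contentUpTo (.inr c) k = lam k + (Finset.univ.filter (fun b : Σ i : Fin d, Fin (mu i) =>
      (Box.ReadBefore (lam := lam) (.inr b) (.inr c) ∨ b = c) ∧
        L.barred (.inr b) = false ∧ L.val (.inr b) = k)).card := by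
  rw [contentUpTo, card_filter_box]
  congr 1
  · rw [← card_row lam]
    congr 1
    ext b
    simp [L.lam_unbarred, hl, readBefore_inl]
  · simp only [Sum.inr.injEq]

/-- Inside `mu` it suffices to test at unbarred entries `k'`, where `contentUpTo_eq` translates the
condition into `hcnt`. -/
theorem isYamanouchi_of_cnt {L : SkewBarredTableau lam mu} (hlam : Antitone lam)
    (hmu : mu ∈ boxPartitions d n) (hl : ∀ c, L.val (.inl c) = c.1)
    (S : IsShape d n mu M) (hdn : d ≤ n) (V : L.ValMatches n M)
    (hcnt : ∀ k k' : Fin d, (k' : ℕ) = k + 1 → ∀ j ≤ n,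
      lam k' + L.cnt n k' j ≤ lam k + L.cnt n k j) : L.IsYamanouchi := by
  classical
  intro a k k' hk
  have hlk : lam k' ≤ lam k := hlam (by rw [Fin.le_def]; omega)
  rcases a with a | a
  -- Row `k'` of `lam` is injected into row `k` within each column; the image is read earlier.
  · let f : Box lam mu → Box lam mu := fun b => match b with
      | .inl b => if h : (b.2 : ℕ) < lam k then .inl ⟨k, ⟨b.2, h⟩⟩ else .inl b
      | .inr b => .inr b
    have hin : ∀ b : Box lam mu, (Box.ReadBefore b (.inl a) ∨ b = .inl a) →
        ∃ c : Σ i : Fin d, Fin (lam i), b = .inl c := by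
      rintro (b | b) h
      · exact ⟨b, rfl⟩
      · exfalso
        rcases h with h | h
        · simp only [Box.ReadBefore, Box.x] at h
          omega
        · simp at h
    refine Finset.card_le_card_of_injOn f ?_ ?_
    · intro b hb
      simp only [Finset.coe_filter, Finset.mem_univ, true_and, Set.mem_ofPred_eq] at hb ⊢
      obtain ⟨h1, -, h3⟩ := hb
      obtain ⟨c, rfl⟩ := hin b h1
      rw [hl] at h3
      have h4 : (c.2 : ℕ) < lam k := by
        have h5 := c.2.2
        have h6 : lam c.1 = lam k' := by rw [h3]
        omega
      simp only [f, h4, ↓reduceDIte, L.lam_unbarred, hl, and_true]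
      left
      have h5 : (c.1 : ℕ) = k + 1 := by rw [h3, hk]
      rcases h1 with h1 | h1
      · simp only [Box.ReadBefore, Box.x, Box.y] at h1 ⊢
        omega
      · obtain rfl := Sum.inl_injective h1
        simp only [Box.ReadBefore, Box.x, Box.y, true_and]
        omega
    · intro b hb b' hb' he
      simp only [Finset.coe_filter, Finset.mem_univ, true_and, Set.mem_ofPred_eq] at hb hb'
      obtain ⟨c, rfl⟩ := hin b hb.1
      obtain ⟨c', rfl⟩ := hin b' hb'.1
      have h3 := hb.2.2
      have h3' := hb'.2.2
      rw [hl] at h3 h3'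
      obtain ⟨i, j⟩ := c
      obtain ⟨i', j'⟩ := c'
      simp only at h3 h3'
      subst h3 h3'
      have h4 : (j : ℕ) < lam k := by omega
      have h4' : (j' : ℕ) < lam k := by omega
      simp only [f, h4, h4', ↓reduceDIte, Sum.inl.injEq, Sigma.mk.injEq, heq_eq_eq, true_and,
        Fin.mk.injEq] at he
      rw [Fin.ext he]
  · by_cases hex : ∃ b : Σ i : Fin d, Fin (mu i),
        (Box.ReadBefore (lam := lam) (.inr b) (.inr a) ∨ b = a) ∧
        L.barred (.inr b) = false ∧ L.val (.inr b) = k'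
    -- The smallest diagonal number belongs to the entry `k'` that is read last. Up to it all
    -- relevant entries `k'` have been counted.
    · obtain ⟨b, hb, hmin⟩ := Finset.exists_min_image
        (Finset.univ.filter (fun b : Σ i : Fin d, Fin (mu i) =>
          (Box.ReadBefore (lam := lam) (.inr b) (.inr a) ∨ b = a) ∧
            L.barred (.inr b) = false ∧ L.val (.inr b) = k'))
        (fun b => n - d + (b.1 : ℕ) + k' - b.2)
        (by obtain ⟨b, hb⟩ := hex; exact ⟨b, by simpa using hb⟩)
      simp only [Finset.mem_filter, Finset.mem_univ, true_and] at hb hmin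
      have h1 : L.contentUpTo (.inr a) k' ≤
          lam k' + L.cnt n k' (n - d + (b.1 : ℕ) + k' - b.2) := by
        rw [contentUpTo_inr hl, cnt]
        refine Nat.add_le_add_left (Finset.card_le_card fun e => ?_) _
        simp only [Finset.mem_filter, Finset.mem_univ, true_and]
        intro he
        exact ⟨he.2.1, congrArg _ he.2.2, hmin e he⟩
      have h2 : L.contentUpTo (.inr b) k ≤ L.contentUpTo (.inr a) k :=
        contentUpTo_mono k (hb.1.imp_right fun h => by rw [h])
      have h3 : (L.val (.inr b) : ℕ) = k' := by rw [hb.2.2]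
      rw [contentUpTo_eq hmu hl b (h3.trans hk), h3] at h2
      have h4 := diag_of_box S hdn hmu V h3 rfl
      have h5 := hcnt k k' hk _ h4.1.le
      omega
    · push Not at hex
      rw [contentUpTo_inr hl, contentUpTo_inr hl, Finset.filter_false_of_mem]
      · simp only [Finset.card_empty]
        omega
      · rintro b - ⟨h1, h2, h3⟩
        exact hex b h1 h2 h3

/-- The number `ω` is the displacement of the token on line `A + 1`, the last line before the
diagonal of `c`, from its position for an empty partition. -/
theorem Matches.omega_add (hdn : d ≤ n) (hmu : mu ∈ boxPartitions d n)
    {L : SkewBarredTableau lam mu} (h : IsArray d n lam mu nu M p)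
    (m : L.Matches n M p) (c : Σ i : Fin d, Fin (mu i)) :
    L.omega c + p (L.val (.inr c)) (n - d + c.1 + L.val (.inr c) - c.2 + 1) =
      (n : ℤ) - d + L.val (.inr c) := by
  have h1 := (diag_of_box h.toIsShape hdn hmu m.vals (c := c) rfl rfl).1
  have h2 := m.add_cnt hdn hmu h (L.val (.inr c)).2
    (show n - d + c.1 + L.val (.inr c) - c.2 + 1 ≤ n from h1)
  have h3 := h.top (L.val (.inr c))
  rw [omega, contentBefore_eq hmu m.lam_val]
  omega

/-- Barred entries correspond to labels `one` that keep their position. -/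
theorem Matches.barred_lt (hdn : d ≤ n) (hmu : mu ∈ boxPartitions d n)
    {L : SkewBarredTableau lam mu} (h : IsArray d n lam mu nu M p)
    (m : L.Matches n M p) {c : Σ i : Fin d, Fin (mu i)} (hc : L.barred (.inr c) = true) :
    p (L.val (.inr c)) (n - d + c.1 + L.val (.inr c) - c.2 + 1) <
      n - d + c.1 + L.val (.inr c) - c.2 := by
  have h1 := diag_of_box h.toIsShape hdn hmu m.vals (c := c) rfl rfl
  have h2 := (m.bars c).1 hc
  have hu := (L.val (.inr c)).2
  have h3 := h.row _ hu _ h1.1.le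
  have h4 := h.col (L.val (.inr c) + 1) hu _ h1.1
  have h5 := h.pos _ hu _ h1.1.le (by omega)
  omega

/-- Every pair of arrays comes from a tableau. -/
theorem _root_.PuzzleTableau.IsArray.exists_tableau (hdn : d ≤ n)
    (hlam : lam ∈ boxPartitions d n) (hmu : mu ∈ boxPartitions d n)
    (h : IsArray d n lam mu nu M p) :
    ∃ L ∈ positiveTableaux lam mu nu, L.Matches n M p := by
  classical
  have S := h.toIsShape
  -- By `diag` the condition is inherited by smaller `u`, and by `first` it holds at `u = 0`. So the
  -- largest `u` is the entry.
  let v : ℕ → ℕ → ℕ := fun i j =>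
    Nat.findGreatest (fun u => i + 1 ≤ M u (n - d + i + u - j)) (d - 1 - i)
  have hv : ∀ i j, InShape mu i j → ∀ u, i + u < d →
      (u ≤ v i j ↔ i + 1 ≤ M u (n - d + i + u - j)) := by
    intro i j hs u hu
    have hj : j < n - d := hs.2.trans_le (hmu.2 _)
    constructor
    · intro hle
      have h0 : i + 1 ≤ M 0 (n - d + i + 0 - j) := by
        have h1 := (h.first ⟨i, hs.1⟩ (n - d + i + 0 - j) (by omega)).2
        have h2 := hs.2
        simp only at h1
        omega
      have h1 : i + 1 ≤ M (v i j) (n - d + i + v i j - j) :=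
        Nat.findGreatest_spec (P := fun u => i + 1 ≤ M u (n - d + i + u - j))
          (Nat.zero_le _) h0
      have h2 : v i j ≤ d - 1 - i := Nat.findGreatest_le _
      have h3 : ∀ k ≤ v i j, i + 1 ≤ M (v i j - k) (n - d + i + (v i j - k) - j) := by
        intro k
        induction k with
        | zero => simpa using h1
        | succ k ih =>
          intro hk
          have h4 := ih (by omega)
          have h5 := h.diag (v i j - (k + 1)) (by omega) (n - d + i + (v i j - (k + 1)) - j)
            (by omega)
          rw [show v i j - (k + 1) + 1 = v i j - k by omega,
            show n - d + i + (v i j - (k + 1)) - j + 1 = n - d + i + (v i j - k) - j by omega] at h5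
          omega
      have := h3 (v i j - u) (by omega)
      rwa [Nat.sub_sub_self hle] at this
    · intro hP
      exact Nat.le_findGreatest (by omega) hP
  have hvd : ∀ i j, i < d → v i j + i < d := by
    intro i j hi
    have : v i j ≤ d - 1 - i := Nat.findGreatest_le _
    omega
  have hrow : ∀ i j j', InShape mu i j → j' ≤ j → v i j ≤ v i j' := by
    intro i j j' hs hj
    have h1 := hvd i j hs.1
    have h2 := (hv i j hs (v i j) (by omega)).1 le_rfl
    refine (hv i j' ⟨hs.1, hj.trans_lt hs.2⟩ (v i j) (by omega)).2 (h2.trans ?_)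
    exact (S.mono (by omega) (by omega) (by omega)).1
  have hcol : ∀ i i' j, InShape mu i j → i' < i → v i j < v i' j := by
    intro i i' j hs hi
    have hj : j < n - d := hs.2.trans_le (hmu.2 _)
    have h1 := hvd i j hs.1
    have h2 := (hv i j hs (v i j) (by omega)).1 le_rfl
    rw [← Nat.succ_le_iff, hv i' j (hs.mono hmu.1 hi.le le_rfl) _ (by omega)]
    -- Raising `u` costs at most one unit of `M`, and going back `i - i' - 1` lines costs at most
    -- that many, which leaves at least `i' + 1`.
    have h3 := h.row (v i j) (by omega) (n - d + i + v i j - j) (by omega)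
    have h4 := (S.mono (u := v i j + 1) (by omega)
      (show n - d + i' + (v i j + 1) - j ≤ n - d + i + v i j - j by omega) (by omega)).2
    simp only [Nat.succ_eq_add_one]
    omega
  let L : SkewBarredTableau lam mu :=
    { val := fun b => match b with
        | .inl c => c.1
        | .inr c => ⟨v c.1 c.2, by have := hvd c.1 c.2 c.1.2; omega⟩
      barred := fun b => match b with
        | .inl _ => false
        | .inr c => decide (p (v c.1 c.2) (n - d + c.1 + v c.1 c.2 - c.2) =
            p (v c.1 c.2) (n - d + c.1 + v c.1 c.2 - c.2 + 1))
      lam_unbarred := fun _ => rfl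
      row_weak := by
        rintro (a | a) (b | b) h1 h2
        · simp only [Box.y] at h1
          rw [Fin.le_def]
          have := a.1.2
          have := b.1.2
          simp only
          omega
        · simp only [Box.y] at h1
          have := a.1.2
          have := b.1.2
          omega
        · simp only [Box.y] at h1
          have := a.1.2
          have := b.1.2
          omega
        · simp only [Box.y, Box.x] at h1 h2
          have h3 : (a.1 : ℕ) = b.1 := by omega
          rw [Fin.le_def]
          simp only
          rw [← h3]
          exact hrow _ _ _ (inShape a) (by omega)
      col_strict := by
        rintro (a | a) (b | b) h1 h2
        · simp only [Box.y] at h2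
          rw [Fin.lt_def]
          have := a.1.2
          have := b.1.2
          simp only
          omega
        · simp only [Box.x] at h1
          omega
        · simp only [Box.x] at h1
          omega
        · simp only [Box.y, Box.x] at h1 h2
          have h3 : (b.2 : ℕ) = a.2 := by omega
          rw [Fin.lt_def]
          simp only
          rw [h3]
          exact hcol _ _ _ (inShape a) (by omega) }
  have hentry : ∀ i j, InShape mu i j → L.entry i j = v i j := by
    intro i j hs
    rw [entry, dif_pos hs]
  have m : L.Matches n M p := by
    refine ⟨fun _ => rfl, ?_, ?_⟩
    · intro i j hs u hu
      rw [hentry i j hs]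
      exact hv i j hs u hu
    · intro c
      exact decide_eq_true_iff
  have hcnt : ∀ (u : Fin d) (j : ℕ), j ≤ n → p u j + (lam u + L.cnt n u j) = n - d + u := by
    intro u j hj
    have h1 := m.add_cnt hdn hmu h u.2 hj
    have h2 := h.top u
    omega
  refine ⟨L, ⟨?_, ?_, ?_⟩, m⟩
  · refine isYamanouchi_of_cnt hlam.1 hmu m.lam_val S hdn m.vals ?_
    intro k k' hk j hj
    have h1 := hcnt k j hj
    have h2 := hcnt k' j hj
    have h3 := h.lt_succ k (by have := k'.2; omega) j hj
    rw [← hk] at h3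
    omega
  · funext k
    rw [content_eq (n := n) m.lam_val k]
    have h1 := hcnt k 0 (Nat.zero_le n)
    have h2 := h.bot k
    omega
  · intro ij hij
    obtain ⟨c, hc, rfl⟩ := Multiset.mem_map.1 hij
    rw [Finset.mem_val, barredBoxes, Finset.mem_filter] at hc
    have h1 := m.omega_add hdn hmu h c
    have h2 := m.barred_lt hdn hmu h hc.2
    have h3 := (diag_of_box S hdn hmu m.vals (c := c) rfl rfl).2.1
    simp only [cFactor, colNum, rowNum]
    omega

end SkewBarredTableau

/-! ### Equivariant pieces and barred entries -/

theorem horizLab_eq_eqv {x o : Lab} : horizLab x o = .eqv ↔ x = .zero ∧ o = .one := by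
  cases x <;> cases o <;> simp [horizLab]

/-- The equivariant pieces of the labeling that is given by a pair of arrays. -/
theorem IsArray.arrayLab_eq_eqv {d n : ℕ} {lam mu nu : Fin d → ℕ} {M p : ℕ → ℕ → ℕ}
    (h : IsArray d n lam mu nu M p) {a b : ℕ} (hab : a + b + 2 ≤ n) :
    arrayLab d M p (.horiz a (b + 1)) = .eqv ↔ ∃ u < d, p u (a + b + 1) = p u (a + b + 1 + 1) ∧
      p u (a + b + 1 + 1) = a ∧ M u (a + b + 1) = M (u + 1) (a + b + 1 + 1) + 1 := by
  obtain ⟨A, hA⟩ : ∃ A, A = a + b + 1 := ⟨_, rfl⟩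
  have hAn : A < n := by omega
  rw [arrayLab, horizLab_eq_eqv, show a + (b + 1) = A by omega, ← hA]
  have hlt := h.lt_of_lt (j := A + 1) hAn
  constructor
  · rintro ⟨h1, h2⟩
    have h3 : ∃ u < d, p u (A + 1) = a := by
      by_contra hc
      push Not at hc
      rw [wLab_of_ne hc] at h2
      simp at h2
    obtain ⟨u, hu, rfl⟩ := h3
    have hst := h.step u hu A hAn
    have hr := h.row u hu (A + 1) hAn
    have hc := h.col u hu.le A hAn
    have h4 : M u (A + 1) = M (u + 1) (A + 1) + 1 := by
      rcases h.wLab_of_eq (j := A + 1) hAn hu with h4 | h4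
      · exact h4.2
      · rw [h4.1] at h2
        simp at h2
    rw [xLab, numBefore_self hlt hu] at h1
    split_ifs at h1 with h5 h6
    have h7 : ¬ p u A + 1 = p u (A + 1) := fun h7 => h5 ⟨u, hu, rfl, h7⟩
    exact ⟨u, hu, by omega, rfl, by omega⟩
  · rintro ⟨u, hu, h1, rfl, h2⟩
    have hr := h.row u hu (A + 1) hAn
    have hc := h.col u hu.le A hAn
    constructor
    · rw [xLab_of_not_mid, numBefore_self hlt hu, if_neg (by omega)]
      rintro v hv ⟨h3, h4⟩
      obtain rfl := h.inj hAn hv hu h3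
      omega
    · rcases h.wLab_of_eq (j := A + 1) hAn hu with h4 | h4
      · exact h4.1
      · omega

open SkewBarredTableau in
/-- A puzzle and a tableau that are encoded by the same arrays have the same factors. -/
theorem factors_eq {d n : ℕ} (hdn : d ≤ n) {lam mu nu : Fin d → ℕ} {M p : ℕ → ℕ → ℕ}
    (hmu : mu ∈ boxPartitions d n) (h : IsArray d n lam mu nu M p) {P : Puzzle n}
    (hP : P.Fits (arrayLab d M p)) {L : SkewBarredTableau lam mu} (m : L.Matches n M p) :
    P.cFactors = L.cFactors ∧ P.bigCFactors = L.bigCFactors n := by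
  classical
  let A : (Σ i : Fin d, Fin (mu i)) → ℕ := fun c => n - d + c.1 + L.val (.inr c) - c.2
  let q : (Σ i : Fin d, Fin (mu i)) → ℕ := fun c => p (L.val (.inr c)) (A c + 1)
  -- A piece at `(a, b)` has its middle edge between the lines `A` and `A + 1` with `A = a + b + 1`,
  -- and `a` is the position of the token that stays.
  let f : (Σ i : Fin d, Fin (mu i)) → Piece := fun c => ⟨.equivariant, q c, A c - 1 - q c⟩
  have hA : ∀ c, A c < n ∧ (c.2 : ℕ) + A c = n - d + c.1 + L.val (.inr c) ∧
      M (L.val (.inr c)) (A c) = M (L.val (.inr c) + 1) (A c + 1) + 1 := fun c => by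
    have := diag_of_box h.toIsShape hdn hmu m.vals (c := c) rfl rfl
    exact ⟨this.1, this.2.1, this.2.2.1⟩
  have hq : ∀ c ∈ L.barredBoxes, q c < A c := by
    intro c hc
    rw [barredBoxes, Finset.mem_filter] at hc
    exact m.barred_lt hdn hmu h hc.2
  have hinj : Set.InjOn f L.barredBoxes := by
    intro c hc c' hc' he
    have h1 := hq c hc
    have h2 := hq c' hc'
    simp only [f, Piece.mk.injEq, true_and] at he
    have h3 : A c = A c' := by omega
    have h4 : (L.val (.inr c) : ℕ) = L.val (.inr c') := by
      refine h.inj (j := A c + 1) (hA c).1 (L.val (.inr c)).2 (L.val (.inr c')).2 ?_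
      have := he.1
      simp only [q] at this
      rwa [← h3] at this
    refine box_unique h.toIsShape hdn hmu m.vals rfl h4.symm ?_
    have h5 := h3
    simp only [A] at h5
    rw [← h4] at h5
    exact h5
  have himg : P.equivariantPieces = L.barredBoxes.image f := by
    ext r
    rw [Puzzle.equivariantPieces, Finset.mem_filter, Finset.mem_image]
    constructor
    · rintro ⟨h1, h2⟩
      obtain ⟨k, a, b⟩ := r
      simp only at h2
      subst h2
      obtain ⟨h3, h4⟩ := hP.equivariant_mem_iff.1 h1
      obtain ⟨u, hu, h5, h6, h7⟩ := (h.arrayLab_eq_eqv h3).1 h4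
      obtain ⟨c, h8, h9⟩ := exists_box h.toIsShape hdn hmu m.vals hu (by omega) h7
      subst h8
      refine ⟨c, ?_, ?_⟩
      · rw [barredBoxes, Finset.mem_filter]
        refine ⟨Finset.mem_univ _, (m.bars c).2 ?_⟩
        rw [h9]
        exact h5
      · have h10 : A c = a + b + 1 := h9
        have h11 : q c = a := by simp only [q, h10]; exact h6
        simp only [f, h10, h11, Piece.mk.injEq, true_and]
        omega
    · rintro ⟨c, hc, rfl⟩
      have h1 := hq c hc
      have h2 := hA c
      rw [barredBoxes, Finset.mem_filter] at hc
      refine ⟨?_, rfl⟩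
      rw [hP.equivariant_mem_iff]
      have h3 : q c + (A c - 1 - q c) + 1 = A c := by omega
      refine ⟨by omega, (h.arrayLab_eq_eqv (by omega)).2 ⟨L.val (.inr c), (L.val (.inr c)).2, ?_⟩⟩
      rw [h3]
      exact ⟨(m.bars c).1 hc.2, rfl, h2.2.2⟩
  have hval : P.equivariantPieces.val = L.barredBoxes.val.map f := by
    rw [himg, Finset.image_val_of_injOn hinj]
  have key : ∀ c ∈ L.barredBoxes, L.omega c + q c = (n : ℤ) - d + L.val (.inr c) :=
    fun c _ => m.omega_add hdn hmu h c
  constructor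
  · rw [Puzzle.cFactors, SkewBarredTableau.cFactors, hval, Multiset.map_map]
    refine Multiset.map_congr rfl fun c hc => ?_
    have h1 := key c hc
    have h2 := hA c
    have h3 := hq c hc
    simp only [Function.comp, f, Piece.edgeE, Piece.edgeF, cFactor, absVal, colNum, rowNum,
      Prod.mk.injEq]
    constructor <;> omega
  · rw [Puzzle.bigCFactors, SkewBarredTableau.bigCFactors, hval, Multiset.map_map]
    refine Multiset.map_congr rfl fun c hc => ?_
    have h1 := key c hc
    have h2 := hA c
    have h3 := hq c hc
    simp only [Function.comp, f, Piece.edgeE, Piece.edgeF, bigCFactor, absVal, colNum, rowNum,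
      Prod.mk.injEq]
    constructor <;> omega

end PuzzleTableau

/-! ### The bijection -/

theorem proposition8p1 (d n : ℕ) (hd : 0 < d) (hdn : d ≤ n) (lam mu nu : Fin d → ℕ)
    (hlam : lam ∈ PuzzleTableau.boxPartitions d n) (hmu : mu ∈ PuzzleTableau.boxPartitions d n)
    (hnu : nu ∈ PuzzleTableau.boxPartitions d n) :
    ∃ Φ : PuzzleTableau.puzzles d n lam mu nu → PuzzleTableau.positiveTableaux lam mu nu,
      Function.Bijective Φ ∧
      ∀ P : PuzzleTableau.puzzles d n lam mu nu,
        P.1.cFactors = (Φ P).1.cFactors ∧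
        P.1.bigCFactors = (Φ P).1.bigCFactors n ∧
        PuzzleTableau.evalFactors P.1.cFactors =
          PuzzleTableau.evalFactors (Φ P).1.cFactors ∧
        PuzzleTableau.evalFactors P.1.bigCFactors =
          PuzzleTableau.evalFactors ((Φ P).1.bigCFactors n) := by
  open PuzzleTableau in
  have hex : ∀ P : puzzles d n lam mu nu, ∃ L : positiveTableaux lam mu nu, ∃ M p,
      IsArray d n lam mu nu M p ∧ P.1.Fits (arrayLab d M p) ∧ L.1.Matches n M p := by
    intro P
    obtain ⟨M, p, h, hP⟩ := P.1.exists_isArray hdn hlam hmu hnu P.2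
    obtain ⟨L, hL, m⟩ := h.exists_tableau hdn hlam hmu
    exact ⟨⟨L, hL⟩, M, p, h, hP, m⟩
  choose Φ hΦ using hex
  -- Injectivity: a tableau determines its arrays in range, these the labels, and these the puzzle.
  -- Surjectivity runs the same chain backwards.
  refine ⟨Φ, ⟨fun P P' he => ?_, fun L => ?_⟩, fun P => ?_⟩
  · obtain ⟨M, p, h, hP, m⟩ := hΦ P
    obtain ⟨M', p', h', hP', m'⟩ := hΦ P'
    rw [← he] at m'
    have hag := m'.arrays_unique hdn hmu h' h m
    exact Subtype.ext (hP.eq (hP'.congr fun t ht e het =>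
      PuzzleTableau.arrayLab_congr hag ht het))
  · obtain ⟨M, p, h, m⟩ := PuzzleTableau.SkewBarredTableau.exists_isArray hdn hlam hmu hnu L.2
    obtain ⟨P, hP, hf⟩ := h.exists_puzzle hdn hlam hmu hnu
    refine ⟨⟨P, hP⟩, Subtype.ext ?_⟩
    obtain ⟨M', p', h', hf', m'⟩ := hΦ ⟨P, hP⟩
    exact m'.eq hmu m (h'.eq_of_arrayLab h fun t ht e het => hf'.eq_on hf ht het) hdn
  · obtain ⟨M, p, h, hP, m⟩ := hΦ P
    obtain ⟨h1, h2⟩ := PuzzleTableau.factors_eq hdn hmu h hP m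
    exact ⟨h1, h2, by rw [h1], by rw [h2]⟩
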